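/- Write $(\cdot,\cdot)$ for the standard inner product and call $(v,v)$ the norm of $v$. For $n\ge 1$ let $A_n=\{x\in\mathbb{Z}^{n+1} : \sum_i x_i=0\}$ and $\alpha_n=\left(\frac1{n+1},\dots,\frac1{n+1},-\frac n{n+1}\right)\in\mathbb{R}^{n+1}$. In $\mathbb{R}^{10}\oplus\mathbb{R}^{10}\oplus\mathbb{R}^{2}$ put $$L=A_9\oplus A_9\oplus A_1,\quad \alpha=(\alpha_9,2\alpha_9,\alpha_1),\quad \Lambda=L+\mathbb{Z}\alpha,\quad r=(0,0,2\alpha_1)=(0,0,(1,-1)),$$ $$X=\{\gamma\in\Lambda : (\gamma,\gamma)=3,\ (\gamma,r)=1\}.$$ Let $\Lambda^*$ be the dual lattice, i.e. the set of $v$ in the real span of $\Lambda$ with $(v,x)\in\mathbb{Z}$ for all $x\in\Lambda$. For a real number $s\ge 1$ and a vector $\rho$ of norm $2$ in a Euclidean space, an affine equiangular set with norm $s$ with respect to $\rho$ is a finite set $\omega$ of vectors of that space such that $(u,\rho)=1$ and $(u,u)=s$ for all $u\in\omega$, and $(u,u')\in\{0,1\}$ for all distinct $u,u'\in\omega$.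 It is strongly maximal if no affine equiangular set with norm $s$ with respect to $\rho$ properly contains $\omega$, even after the underlying Euclidean space is isometrically embedded in a Euclidean space of larger dimension. A maximum affine equiangular set in $X$ is an affine equiangular set $\omega\subseteq X$ with norm $3$ with respect to $r$ whose cardinality is largest among all such subsets of $X$. Theorem. Every maximum affine equiangular set $\omega$ in $X$ with respect to $r$ is strongly maximal, and $\omega\cup\{r\}$ generates $\Lambda$ as an additive group. Moreover, there is no vector $v\in\Lambda^*\setminus\Lambda$ with $(v,v)\le 3$ and $(v,r)=1$. -/

import Mathlib

open scoped InnerProductSpace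

namespace AffEquiangular

noncomputable section

section General

variable {V : Type*} [NormedAddCommGroup V] [InnerProductSpace ℝ V]

/-- The finite set `ω` is an affine equiangular set with norm `s` with respect to the
switching root `r` (a vector of norm `(r, r) = 2`). -/
structure IsAES (s : ℝ) (r : V) (ω : Set V) : Prop where
  one_le : 1 ≤ s
  root : ⟪r, r⟫_ℝ = 2
  finite : ω.Finite
  inner_root : ∀ u ∈ ω, ⟪u, r⟫_ℝ = 1
  inner_self : ∀ u ∈ ω, ⟪u, u⟫_ℝ = s
  inner_ne : ∀ u ∈ ω, ∀ v ∈ ω, u ≠ v → ⟪u, v⟫_ℝ = 0 ∨ ⟪u, v⟫_ℝ = 1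

/-- `ω` is a maximum affine equiangular set in `X`: it has the largest cardinality among
the affine equiangular sets (same norm, same switching root) contained in `X`. -/
def IsMaximumAES (s : ℝ) (r : V) (X ω : Set V) : Prop :=
  IsAES s r ω ∧ ω ⊆ X ∧ ∀ ω' : Set V, IsAES s r ω' → ω' ⊆ X → ω'.ncard ≤ ω.ncard

/-- `ω` is a strongly maximal affine equiangular set: however the underlying space is
isometrically embedded in a Euclidean space `ℝ^M` (of any dimension `M`), no affine
equiangular set properly contains the image of `ω`. -/
def IsStronglyMaximal [FiniteDimensional ℝ V] (s : ℝ) (r : V) (ω : Set V) : Prop :=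
  IsAES s r ω ∧
    ∀ (M : ℕ) (f : V →ₗᵢ[ℝ] EuclideanSpace ℝ (Fin M)) (ω' : Set (EuclideanSpace ℝ (Fin M))),
      IsAES s (f r) ω' → ¬ (f '' ω ⊂ ω')

/-- The dual of a lattice `Γ`: the vectors of the real span of `Γ` whose inner products
with all elements of `Γ` are integers. -/
def dualLattice (Γ : AddSubgroup V) : Set V :=
  {v | v ∈ Submodule.span ℝ (Γ : Set V) ∧ ∀ x ∈ Γ, ∃ n : ℤ, ⟪v, x⟫_ℝ = n}

end General

/-- The root lattice `A_n`: integer vectors in `ℝ^(n+1)` with coordinate sum zero. -/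
def rootLatticeA (n : ℕ) : AddSubgroup (Fin (n + 1) → ℝ) where
  carrier := {x | (∀ i, ∃ m : ℤ, x i = m) ∧ ∑ i, x i = 0}
  zero_mem' := ⟨fun _ => ⟨0, by simp⟩, by simp⟩
  add_mem' := by
    rintro x y ⟨hx, hx0⟩ ⟨hy, hy0⟩
    refine ⟨fun i => ?_, by simp [Finset.sum_add_distrib, hx0, hy0]⟩
    obtain ⟨a, ha⟩ := hx i
    obtain ⟨b, hb⟩ := hy i
    exact ⟨a + b, by simp [ha, hb]⟩
  neg_mem' := by
    rintro x ⟨hx, hx0⟩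
    refine ⟨fun i => ?_, by simp [hx0]⟩
    obtain ⟨a, ha⟩ := hx i
    exact ⟨-a, by simp [ha]⟩

/-- `α_n = (1/(n+1), …, 1/(n+1), -n/(n+1))`. -/
def alphaA (n : ℕ) : Fin (n + 1) → ℝ :=
  fun i => if i = Fin.last n then -(n : ℝ) / (n + 1) else 1 / (n + 1)

/-- The ambient Euclidean space `ℝ^10 ⊕ ℝ^10 ⊕ ℝ^2`. -/
abbrev Amb : Type := EuclideanSpace ℝ (Fin 10 ⊕ Fin 10 ⊕ Fin 2)

/-- The vector `(x, y, z)` of `ℝ^10 ⊕ ℝ^10 ⊕ ℝ^2`. -/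
def triple (x y : Fin 10 → ℝ) (z : Fin 2 → ℝ) : Amb :=
  WithLp.toLp 2 (Sum.elim x (Sum.elim y z))

/-- The lattice `L = A_9 ⊕ A_9 ⊕ A_1`. -/
def latticeL : AddSubgroup Amb where
  carrier := {v | ∃ x ∈ rootLatticeA 9, ∃ y ∈ rootLatticeA 9, ∃ z ∈ rootLatticeA 1,
    v = triple x y z}
  zero_mem' := ⟨0, zero_mem _, 0, zero_mem _, 0, zero_mem _, by
    ext i; rcases i with i | i | i <;> simp [triple]⟩
  add_mem' := by
    rintro _ _ ⟨x, hx, y, hy, z, hz, rfl⟩ ⟨x', hx', y', hy', z', hz', rfl⟩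
    refine ⟨x + x', add_mem hx hx', y + y', add_mem hy hy', z + z', add_mem hz hz', ?_⟩
    ext i; rcases i with i | i | i <;> simp [triple]
  neg_mem' := by
    rintro _ ⟨x, hx, y, hy, z, hz, rfl⟩
    refine ⟨-x, neg_mem hx, -y, neg_mem hy, -z, neg_mem hz, ?_⟩
    ext i; rcases i with i | i | i <;> simp [triple]

/-- `α = (α_9, 2 α_9, α_1)`. -/
def alpha : Amb := triple (alphaA 9) ((2 : ℝ) • alphaA 9) (alphaA 1)

/-- The overlattice `Λ = L + ℤ α` of `A_9 ⊕ A_9 ⊕ A_1`. -/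
def latticeLambda : AddSubgroup Amb := latticeL ⊔ AddSubgroup.zmultiples alpha

/-- The switching root `r = (0, 0, 2 α_1) = (0, 0, (1, -1))`. -/
def switchingRoot : Amb := triple 0 0 ((2 : ℝ) • alphaA 1)

/-- `X`: the vectors of norm `3` in `Λ` whose inner product with `r` is `1`. -/
def setX : Set Amb :=
  {γ | γ ∈ latticeLambda ∧ ⟪γ, γ⟫_ℝ = 3 ∧ ⟪γ, switchingRoot⟫_ℝ = 1}

end

end AffEquiangular

namespace AffEquiangular
open Finset

/-! A vector of `Λ*` of norm at most 3 and inner product 1 with `r` has glue classes `a`, `b` in the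
two copies of `A_9` with `a + 2b ≡ 5 (mod 10)` and `a(10 - a) + b(10 - b) ≤ 25`. Only (5,0), (1,2)
and (9,8) survive, always with equality, so the vector is a `cosetVec S T` and lies in `Λ`. This
settles the last claim (`exists_isShape_of_mem_dualLattice`).

Type (1,2) is an edge `T` of the complete graph on ten vertices carrying a colour, type (9,8) is its
image under `u ↦ r - u`, and type (5,0) is a five-element set. Equiangularity says that each edge is
used at most once, that adjacent edges get different colours, and that the five-element sets
pairwise meet in 2 or 3 points; edges and five-element sets do not constrain each other. A maximum
set is therefore a proper colouring of all 45 edges together with a largest balanced family, which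
has at least 12 members (`IsMaximumAES.exists_colouring`).

If `ω ∪ {r}` generated a proper subgroup of `Λ`, a nonzero character to some `ZMod p` would vanish
on it. Its values on roots label the colours and the vertices so that a colour's label is the sum of
the labels at the two ends of each of its edges. On a symmetric Latin square, counting and power
sums show that nonconstant vertex labels need `p = 2`, which parity excludes, or `p = 5` with every
label occurring twice. In the latter case the family consists of zero-sum sets and has at most 11
members. So the labels are constant, and the character is zero (`LatinLabelling.const`,
`latticeLambda_le_of_mem`).

For strong maximality, project an additional vector to the span of `Λ`. As `ω ∪ {r}` generates `Λ`,
the projection lies in `Λ*`, hence in `X`, and it would enlarge `ω` inside `X`. -/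

/-! ### Labellings of symmetric Latin squares of order ten -/

/-- A symmetric Latin square `col` of order ten, together with a labelling `f` of its symbols and
`g` of its rows, such that `f (col j k) = g j + g k` away from the diagonal. -/
structure LatinLabelling {K : Type*} [AddCommGroup K] (col : Fin 10 → Fin 10 → Fin 10)
    (f g : Fin 10 → K) : Prop where
  symm : ∀ j k, col j k = col k j
  bij : ∀ j, Function.Bijective (col j)
  label : ∀ j k, j ≠ k → f (col j k) = g j + g k

namespace LatinLabelling

section Mult

variable {K : Type*} [DecidableEq K] {g : Fin 10 → K}

/-- The number of indices with a given label. -/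
def mult (g : Fin 10 → K) (v : K) : ℕ := #{k | g k = v}

theorem sum_mult [Fintype K] (g : Fin 10 → K) : ∑ v, mult g v = 10 := by
  simpa [mult] using
    (Finset.card_eq_sum_card_fiberwise (s := univ) (t := univ) (f := g) (by simp)).symm

theorem mult_pos_iff {v : K} : 0 < mult g v ↔ ∃ k, g k = v := by
  simp [mult, Finset.card_pos, Finset.filter_nonempty_iff]

theorem ten_le_of_mult_le (g : Fin 10 → K) {m : ℕ} (hm : ∀ v, mult g v ≤ m) :
    10 ≤ #(univ.image g) * m := by
  have := Finset.card_le_mul_card_image (f := g) (univ : Finset (Fin 10)) m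
    (fun b _ => by simpa [mult] using hm b)
  simpa [mul_comm] using this

end Mult

section Group

variable {K : Type*} [AddCommGroup K] {col : Fin 10 → Fin 10 → Fin 10} {f g : Fin 10 → K}

/-- Row `j` meets every symbol once, and the label rule applies to every cell of it except the
diagonal one, whose term is exchanged. -/
theorem sum_comp (h : LatinLabelling col f g) {A : Type*} [AddCommGroup A] (φ : K → A)
    (j : Fin 10) :
    ∑ c, φ (f c) = ∑ k, φ (g j + g k) - φ (g j + g j) + φ (f (col j j)) := by
  rw [← (h.bij j).sum_comp (fun c => φ (f c)),
    ← Finset.add_sum_erase _ _ (mem_univ j),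
    ← Finset.add_sum_erase _ (fun k => φ (g j + g k)) (mem_univ j)]
  have : ∑ x ∈ univ.erase j, φ (f (col j x)) = ∑ x ∈ univ.erase j, φ (g j + g x) :=
    Finset.sum_congr rfl fun k hk => by rw [h.label j k (Finset.ne_of_mem_erase hk).symm]
  rw [this]
  abel

theorem label_diag (h : LatinLabelling col f g) (j : Fin 10) :
    f (col j j) = (∑ c, f c - ∑ k, g k) - 8 • g j := by
  have := h.sum_comp (fun x => x) j
  simp only [Finset.sum_add_distrib, Finset.sum_const, Finset.card_univ, Fintype.card_fin] at this
  rw [this]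
  abel

/-- Only the symbol `col 0 0` can have a deviating label. Since `S` and its complement have equal
size, a deviation would unbalance the two sums. -/
theorem const_of_const (h : LatinLabelling col f g) (hg : ∀ j k, g j = g k)
    {S : Finset (Fin 10)} (hS : #S = 5) (hf : ∑ c ∈ S, f c = ∑ c ∈ Sᶜ, f c) (c d : Fin 10) :
    f c = f d := by
  have hne : ∀ c, c ≠ col 0 0 → f c = g 0 + g 0 := by
    intro c hc
    obtain ⟨k, rfl⟩ := (h.bij 0).2 c
    have hk : 0 ≠ k := by rintro rfl; exact hc rfl
    rw [h.label 0 k hk, hg k 0]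
  have key : f (col 0 0) = g 0 + g 0 := by
    set c₀ := col 0 0
    have h1 : ∀ U : Finset (Fin 10), ∑ c ∈ U, f c
        = #U • (g 0 + g 0) + if c₀ ∈ U then f c₀ - (g 0 + g 0) else 0 := by
      intro U
      have : ∀ c, f c = (g 0 + g 0) + if c₀ = c then f c₀ - (g 0 + g 0) else 0 := by
        intro c
        by_cases hc : c = c₀
        · subst hc; simp
        · rw [if_neg (Ne.symm hc), hne c hc, add_zero]
      rw [Finset.sum_congr rfl fun c _ => this c, Finset.sum_add_distrib, Finset.sum_const,
        Finset.sum_ite_eq]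
    have hS' : #Sᶜ = 5 := by rw [Finset.card_compl, hS]; rfl
    rw [h1, h1, hS, hS', add_right_inj] at hf
    by_cases hc : c₀ ∈ S
    · simpa [hc, sub_eq_zero] using hf
    · have := hf.symm
      simpa [hc, sub_eq_zero] using this
  have hall : ∀ c, f c = g 0 + g 0 := fun c => by
    by_cases hc : c = col 0 0
    · rw [hc, key]
    · exact hne c hc
  rw [hall, hall]

variable [DecidableEq K]

/-- The left side does not involve `j`; comparing two rows therefore relates multiplicities of `g`
at different points, up to an error of one from each diagonal term. -/
theorem mult_symbol (h : LatinLabelling col f g) (j : Fin 10) (v : K) :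
    (mult f v : ℤ) = mult g (v - g j) - (if g j + g j = v then 1 else 0)
      + (if f (col j j) = v then 1 else 0) := by
  have := h.sum_comp (fun x => if x = v then (1 : ℤ) else 0) j
  simp only [Finset.sum_boole] at this
  simp only [mult]
  rw [this]
  simp only [eq_sub_iff_add_eq, add_comm]

end Group

section Prime

variable {p : ℕ} [Fact p.Prime] {col : Fin 10 → Fin 10 → Fin 10} {f g : Fin 10 → ZMod p}

/-- If `p` is odd, `g` is not constant and some label occurs three times, then every label
occurs at least twice. -/
theorem two_le_mult (h : LatinLabelling col f g) (hp : p ≠ 2) {i₀ j₀ : Fin 10}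
    (hij : g i₀ ≠ g j₀) {x₀ : ZMod p} (hx₀ : 3 ≤ mult g x₀) (v : ZMod p) : 2 ≤ mult g v := by
  have h2 : (2 : ZMod p) ≠ 0 := by
    intro h0
    have : (p : ℕ) ∣ 2 := (ZMod.natCast_eq_zero_iff 2 p).1 (by exact_mod_cast h0)
    exact hp ((Nat.prime_dvd_prime_iff_eq Fact.out Nat.prime_two).1 this)
  have hdbl : ∀ a b : ZMod p, a + a = b + b → a = b := fun a b hab => by
    rw [← two_mul, ← two_mul] at hab
    exact mul_left_cancel₀ h2 hab
  obtain ⟨x, -, hx⟩ := Finset.exists_max_image (univ : Finset (ZMod p)) (mult g) ⟨x₀, mem_univ _⟩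
  have hx3 : 3 ≤ mult g x := hx₀.trans (hx x₀ (mem_univ _))
  obtain ⟨i, hi⟩ := mult_pos_iff.1 (by omega : 0 < mult g x)
  obtain ⟨j, hj⟩ : ∃ j, g j ≠ x := by
    by_contra! hall
    exact hij ((hall i₀).trans (hall j₀).symm)
  set y := g j with hy
  -- Comparing row `i` with a row labelled `z` loses at most two from `mult g x ≥ 3`.
  have hrefl : ∀ z, 0 < mult g z → 0 < mult g (x + x - z) := by
    intro z hz
    obtain ⟨k, rfl⟩ := mult_pos_iff.1 hz
    have e1 := h.mult_symbol i (x + x)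
    have e2 := h.mult_symbol k (x + x)
    rw [hi, add_sub_cancel_right] at e1
    split_ifs at e1 e2 <;> omega
  -- Here row `j` has `y + y ≠ x + y`, so only one is lost.
  have hshift : ∀ z, 0 < mult g z → 2 ≤ mult g (x + y - z) := by
    intro z hz
    obtain ⟨k, rfl⟩ := mult_pos_iff.1 hz
    have e1 := h.mult_symbol j (x + y)
    have e2 := h.mult_symbol k (x + y)
    rw [← hy, add_sub_cancel_right, if_neg (by simpa using hj)] at e1
    split_ifs at e1 e2 <;> omega
  -- Two reflections compose to the translation by `y - x`, which is nonzero and so generates `ZMod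
  -- p`.
  have hstep : ∀ z, 0 < mult g z → 2 ≤ mult g (z + (y - x)) := by
    intro z hz
    have := hshift _ (hrefl z hz)
    rwa [show x + y - (x + x - z) = z + (y - x) by ring] at this
  have hiter : ∀ n : ℕ, 2 ≤ mult g (x + n * (y - x)) := by
    intro n
    induction n with
    | zero => simpa using by omega
    | succ n ih =>
      have := hstep _ (by omega : 0 < mult g (x + n * (y - x)))
      rwa [show x + (n : ZMod p) * (y - x) + (y - x) = x + ((n + 1 : ℕ) : ZMod p) * (y - x) by
        push_cast; ring] at this
  have hd : y - x ≠ 0 := sub_ne_zero.2 hj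
  have := hiter ((v - x) / (y - x)).val
  rwa [ZMod.natCast_zmod_val, div_mul_cancel₀ _ hd, add_sub_cancel] at this

/-- The second power sum along row `j`: the leading coefficient is `10 - 2² + 8² = 70`. -/
theorem quadratic (h : LatinLabelling col f g) : ∃ b c : ZMod p, ∀ j,
    70 * g j ^ 2 + b * g j + c = 0 := by
  refine ⟨2 * ∑ k, g k - 16 * (∑ c, f c - ∑ k, g k),
    ∑ k, g k ^ 2 + (∑ c, f c - ∑ k, g k) ^ 2 - ∑ c, f c ^ 2, fun j => ?_⟩
  have e := h.sum_comp (fun x => x ^ 2) j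
  rw [h.label_diag j] at e
  have : ∑ k, (g j + g k) ^ 2 = 10 * g j ^ 2 + 2 * g j * ∑ k, g k + ∑ k, g k ^ 2 := by
    simp only [add_sq, Finset.sum_add_distrib, Finset.sum_const, Finset.card_univ,
      Fintype.card_fin, ← Finset.mul_sum]
    simp
  simp only [this, nsmul_eq_mul, Nat.cast_ofNat] at e
  rw [e]
  ring

/-- The third power sum, with leading coefficient `10 - 2³ - 8³ = -510`; it serves `p = 7`, where 70
vanishes but 510 does not. -/
theorem cubic (h : LatinLabelling col f g) : ∃ a b c : ZMod p, ∀ j,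
    (-510) * g j ^ 3 + a * g j ^ 2 + b * g j + c = 0 := by
  refine ⟨3 * ∑ k, g k + 192 * (∑ c, f c - ∑ k, g k),
    3 * ∑ k, g k ^ 2 - 24 * (∑ c, f c - ∑ k, g k) ^ 2,
    ∑ k, g k ^ 3 + (∑ c, f c - ∑ k, g k) ^ 3 - ∑ c, f c ^ 3, fun j => ?_⟩
  have e := h.sum_comp (fun x => x ^ 3) j
  rw [h.label_diag j] at e
  have : ∑ k, (g j + g k) ^ 3
      = 10 * g j ^ 3 + 3 * g j ^ 2 * ∑ k, g k + 3 * g j * ∑ k, g k ^ 2 + ∑ k, g k ^ 3 := by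
    have (a b : ZMod p) : (a + b) ^ 3 = a ^ 3 + 3 * a ^ 2 * b + 3 * a * b ^ 2 + b ^ 3 := by ring
    simp only [this, Finset.sum_add_distrib, Finset.sum_const, Finset.card_univ,
      Fintype.card_fin, ← Finset.mul_sum]
    simp
  simp only [this, nsmul_eq_mul, Nat.cast_ofNat] at e
  rw [e]
  ring

/-- The labels satisfy a cubic equation that is not trivial unless `p` is `2` or `5`. -/
theorem card_image_le (h : LatinLabelling col f g) (h2 : p ≠ 2) (h5 : p ≠ 5) :
    #(univ.image g) ≤ 3 ∧ (p ≠ 7 → #(univ.image g) ≤ 2) := by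
  have hquad : p ≠ 7 → #(univ.image g) ≤ 2 := by
    intro h7
    by_contra! hc
    obtain ⟨b, c, hbc⟩ := h.quadratic
    open Polynomial in
    have hP : (C 70 * X ^ 2 + C b * X + C c : (ZMod p)[X]) = 0 := by
      refine Polynomial.eq_zero_of_natDegree_lt_card_of_eval_eq_zero' _ (univ.image g) ?_
        (lt_of_le_of_lt Polynomial.natDegree_quadratic_le hc)
      intro x hx
      obtain ⟨j, -, rfl⟩ := Finset.mem_image.1 hx
      simpa using hbc j
    have h70 : ((70 : ℕ) : ZMod p) = 0 := by
      have := congrArg (fun P => Polynomial.coeff P 2) hP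
      simpa [Polynomial.coeff_X, Polynomial.coeff_C] using this
    have hp : p ∣ 2 * 5 * 7 := (ZMod.natCast_eq_zero_iff 70 p).1 h70
    have pp : p.Prime := Fact.out
    rcases pp.dvd_mul.1 hp with hp | hp
    · rcases pp.dvd_mul.1 hp with hp | hp
      · exact h2 ((Nat.prime_dvd_prime_iff_eq pp (by norm_num)).1 hp)
      · exact h5 ((Nat.prime_dvd_prime_iff_eq pp (by norm_num)).1 hp)
    · exact h7 ((Nat.prime_dvd_prime_iff_eq pp (by norm_num)).1 hp)
  refine ⟨?_, hquad⟩
  by_cases h7 : p = 7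
  · by_contra! hc
    obtain ⟨a, b, c, hbc⟩ := h.cubic
    open Polynomial in
    have hP : (C (-510) * X ^ 3 + C a * X ^ 2 + C b * X + C c : (ZMod p)[X]) = 0 := by
      refine Polynomial.eq_zero_of_natDegree_lt_card_of_eval_eq_zero' _ (univ.image g) ?_
        (lt_of_le_of_lt Polynomial.natDegree_cubic_le hc)
      intro x hx
      obtain ⟨j, -, rfl⟩ := Finset.mem_image.1 hx
      simpa using hbc j
    have h510 : ((510 : ℕ) : ZMod p) = 0 := by
      have := congrArg (fun P => Polynomial.coeff P 3) hP
      simpa [Polynomial.coeff_X, Polynomial.coeff_C] using this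
    have hp : p ∣ 510 := (ZMod.natCast_eq_zero_iff 510 p).1 h510
    rw [h7] at hp
    norm_num at hp
  · exact (hquad h7).trans (by norm_num)

/-- If no label occurs three times, there are at least five labels, which the polynomial equations
allow only for `p = 5`. Otherwise every label occurs at least twice and one more often, so `2p <
10`; the remaining `p = 3` would use three labels where the quadratic allows two. -/
theorem prime_eq (h : LatinLabelling col f g) {i₀ j₀ : Fin 10} (hij : g i₀ ≠ g j₀) :
    p = 2 ∨ p = 5 ∧ ∀ v, mult g v = 2 := by
  by_cases h2 : p = 2
  · exact Or.inl h2
  have hp3 : 3 ≤ p := by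
    have := (Fact.out : p.Prime).two_le
    omega
  right
  by_cases hm : ∀ v, mult g v ≤ 2
  · have h10 := ten_le_of_mult_le g hm
    have h5 : p = 5 := by
      by_contra h5
      have := (h.card_image_le h2 h5).1
      omega
    refine ⟨h5, ?_⟩
    subst h5
    by_contra! hv
    obtain ⟨v, hv⟩ := hv
    have : ∑ v, mult g v < ∑ _v : ZMod 5, 2 :=
      Finset.sum_lt_sum (fun v _ => hm v) ⟨v, mem_univ _, lt_of_le_of_ne (hm v) hv⟩
    rw [sum_mult] at this
    simp [ZMod.card] at this
  · exfalso
    push Not at hm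
    obtain ⟨x, hx⟩ := hm
    have hall := h.two_le_mult h2 hij hx
    have hsum : ∑ _v : ZMod p, 2 < ∑ v, mult g v :=
      Finset.sum_lt_sum (fun v _ => hall v) ⟨x, mem_univ _, hx⟩
    rw [sum_mult] at hsum
    simp only [Finset.sum_const, Finset.card_univ, ZMod.card, smul_eq_mul] at hsum
    have hp : p = 3 := by
      have : p ≠ 4 := by rintro rfl; exact absurd (Fact.out : Nat.Prime 4) (by norm_num)
      omega
    have him : univ.image g = univ := by
      ext v
      simpa using mult_pos_iff.1 (by have := hall v; omega : 0 < mult g v)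
    have := (h.card_image_le h2 (by omega)).2 (by omega)
    rw [him, Finset.card_univ, ZMod.card] at this
    omega

end Prime

/-- Counting the label 0 in rows of both kinds shows that each vertex label occurs five times, so
every diagonal symbol has label 1. A symbol of label 0 then pairs the rows without fixed points and
preserves `g`, yet the class `g = 0` has odd size. -/
theorem false_of_two {col : Fin 10 → Fin 10 → Fin 10} {f g : Fin 10 → ZMod 2}
    (h : LatinLabelling col f g) {i₀ j₀ : Fin 10} (hij : g i₀ ≠ g j₀)
    (hf : ∑ c, f c = 0) : False := by
  have hval : ∀ a : ZMod 2, a = 0 ∨ a = 1 := by decide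
  have hdbl : ∀ a : ZMod 2, a + a = 0 := by decide
  obtain ⟨i, hi⟩ : ∃ i, g i = 0 := by
    rcases hval (g i₀) with h0 | h0
    · exact ⟨_, h0⟩
    · rcases hval (g j₀) with h1 | h1
      · exact ⟨_, h1⟩
      · exact absurd (h0.trans h1.symm) hij
  obtain ⟨j, hj⟩ : ∃ i, g i = 1 := by
    rcases hval (g i₀) with h0 | h0
    · rcases hval (g j₀) with h1 | h1
      · exact absurd (h0.trans h1.symm) hij
      · exact ⟨_, h1⟩
    · exact ⟨_, h0⟩
  have hs : ∀ k, f (col k k) = ∑ k, g k := by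
    intro k
    rw [h.label_diag k, hf, show (8 : ℕ) • g k = 0 by
      rw [nsmul_eq_mul]; exact zero_mul _, zero_sub, sub_zero]
    exact ZMod.neg_eq_self_mod_two _
  have hm : mult g 0 + mult g 1 = 10 := sum_mult g
  have e1 := h.mult_symbol i 0
  have e2 := h.mult_symbol j 0
  rw [hs, hi, hdbl, if_pos rfl, sub_zero] at e1
  rw [hs, hj, hdbl, if_pos rfl, show (0 - 1 : ZMod 2) = 1 by decide] at e2
  have hm0 : mult g 0 = 5 := by omega
  have hG : ∑ k, g k = 1 := by
    have : ∑ k, g k = (mult g 1 : ZMod 2) := by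
      rw [mult, ← Finset.sum_boole]
      refine Finset.sum_congr rfl fun k _ => ?_
      rcases hval (g k) with h0 | h0 <;> simp [h0]
    rw [this, show mult g 1 = 5 by omega]
    decide
  rw [hG] at e1
  have hpos : 0 < mult f 0 := by
    rw [if_neg (by decide)] at e1
    omega
  obtain ⟨c, hc⟩ := mult_pos_iff.1 hpos
  choose τ hτ using fun k => (h.bij k).2 c
  have hττ : ∀ k, τ (τ k) = k := fun k =>
    (h.bij (τ k)).1 (by rw [hτ, h.symm, hτ])
  have hne : ∀ k, τ k ≠ k := by
    intro k hk
    have := hτ k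
    rw [hk] at this
    have h1 := hs k
    rw [this, hc, hG] at h1
    exact absurd h1 (by decide)
  have heven : ∑ k with g k = 0, (1 : ZMod 2) = 0 := by
    refine Finset.sum_involution (fun k _ => τ k) (fun _ _ => hdbl 1) (fun k _ _ => hne k) ?_
      (fun k _ => hττ k)
    intro k hk
    have hk0 : g k = 0 := (Finset.mem_filter.1 hk).2
    have := h.label k (τ k) (hne k).symm
    rw [hτ, hc, hk0, zero_add] at this
    exact Finset.mem_filter.2 ⟨mem_univ _, this.symm⟩
  rw [Finset.sum_const, show #{k | g k = 0} = 5 from hm0] at heven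
  exact absurd heven (by decide)

/-- Modulo 5, `-8w = 2w`. The count of the label 0 is the same in every row, which forces `∑ f = ∑
g`, and then the two diagonal corrections cancel. -/
theorem mult_eq_two_of_five {col : Fin 10 → Fin 10 → Fin 10} {f g : Fin 10 → ZMod 5}
    (h : LatinLabelling col f g) (hg : ∀ v, mult g v = 2) (v : ZMod 5) : mult f v = 2 := by
  have hN : ∀ v w : ZMod 5, (mult f v : ℤ) = 2 - (if w + w = v then 1 else 0)
      + (if (∑ c, f c - ∑ k, g k) - 8 • w = v then 1 else 0) := by
    intro v w
    obtain ⟨k, rfl⟩ := mult_pos_iff.1 (by rw [hg w]; norm_num : 0 < mult g w)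
    rw [h.mult_symbol k v, hg, h.label_diag]
    rfl
  have hκ : ∑ c, f c - ∑ k, g k = 0 := by
    generalize ∑ c, f c - ∑ k, g k = κ at hN
    have key : ∀ κ : ZMod 5, (∀ w : ZMod 5, (2 : ℤ) - (if (0 : ZMod 5) + 0 = 0 then 1 else 0)
      + (if κ - 8 • (0 : ZMod 5) = 0 then 1 else 0) = 2 - (if w + w = 0 then 1 else 0)
      + (if κ - 8 • w = 0 then 1 else 0)) → κ = 0 := by decide
    exact key κ fun w => by rw [← hN, ← hN]
  have := hN v 0
  rw [hκ] at this
  simp only [add_zero, smul_zero, sub_zero] at this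
  split_ifs at this <;> omega

end LatinLabelling

/-! ### Balanced families of five-element sets and the bound for zero-sum families -/

/-- Five-element subsets of a ten-element set such that any two of them meet in two or three
points. -/
structure IsBalancedFamily (𝒞 : Finset (Finset (Fin 10))) : Prop where
  card : ∀ S ∈ 𝒞, #S = 5
  inter : ∀ S ∈ 𝒞, ∀ S' ∈ 𝒞, S ≠ S' → #(S ∩ S') = 2 ∨ #(S ∩ S') = 3

/-- The number of elements of `S` among `v` and `v + 5`. -/
def blockCount (S : Finset (Fin 10)) (v : Fin 5) : Fin 3 :=
  (if Fin.castAdd 5 v ∈ S then 1 else 0) + if Fin.natAdd 5 v ∈ S then 1 else 0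

/-- The sign of a subset `S` of `Fin 10` at `v`: whether `v` lies in `S`. -/
def splitSign (S : Finset (Fin 10)) (v : Fin 5) : ℤ :=
  if Fin.castAdd 5 v ∈ S then 1 else -1

theorem blockCount_inter_of_eq_two (S S' : Finset (Fin 10)) (v : Fin 5) (h : blockCount S v = 2) :
    blockCount (S ∩ S') v = blockCount S' v := by
  revert h
  simp only [blockCount, Finset.mem_inter]
  by_cases h1 : Fin.castAdd 5 v ∈ S <;> by_cases h2 : Fin.natAdd 5 v ∈ S <;> simp [h1, h2, -Fin.natAdd_eq_addNat]

theorem blockCount_inter_of_eq_zero (S S' : Finset (Fin 10)) (v : Fin 5) (h : blockCount S v = 0) :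
    blockCount (S ∩ S') v = 0 := by
  revert h
  simp only [blockCount, Finset.mem_inter]
  by_cases h1 : Fin.castAdd 5 v ∈ S <;> by_cases h2 : Fin.natAdd 5 v ∈ S <;> simp [h1, h2, -Fin.natAdd_eq_addNat]

theorem blockCount_inter_of_eq_one (S S' : Finset (Fin 10)) (v : Fin 5) (h : blockCount S v = 1) :
    (blockCount (S ∩ S') v).val ≤ 1 := by
  revert h
  simp only [blockCount, Finset.mem_inter]
  by_cases h1 : Fin.castAdd 5 v ∈ S <;> by_cases h2 : Fin.natAdd 5 v ∈ S <;>
    by_cases h3 : Fin.castAdd 5 v ∈ S' <;> by_cases h4 : Fin.natAdd 5 v ∈ S' <;>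
    simp [h1, h2, h3, h4, -Fin.natAdd_eq_addNat]

theorem sum_blockCount (S : Finset (Fin 10)) : ∑ v, (blockCount S v).val = #S := by
  have h : #S = ∑ i : Fin (5 + 5), if i ∈ S then 1 else 0 := by
    rw [Finset.sum_boole, Finset.filter_univ_mem]; rfl
  rw [h, Fin.sum_univ_add, ← Finset.sum_add_distrib]
  refine Finset.sum_congr rfl fun v _ => ?_
  unfold blockCount
  split_ifs <;> rfl

theorem sum_mul_blockCount (S : Finset (Fin 10)) :
    (∑ v, v.val * (blockCount S v).val) % 5 = (∑ i ∈ S, i.val) % 5 := by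
  have h : ∑ i ∈ S, i.val = ∑ i : Fin (5 + 5), if i ∈ S then i.val else 0 := by
    rw [Finset.sum_ite_mem, Finset.univ_inter]
  rw [h, Fin.sum_univ_add, ← Finset.sum_add_distrib]
  refine Nat.ModEq.sum fun v _ => ?_
  unfold blockCount
  change _ % 5 = _ % 5
  split_ifs <;> simp
  omega

/-- The possible block counts of a five-element subset with sum divisible by five that contains
both or none of `v` and `v + 5` for some `v`. -/
def IsBlockPattern (t : Fin 5 → Fin 3) : Prop :=
  (∃ v, t v = 1) ∧ ∀ c, t c = 1 →
    (t (c + 1) = 2 ∧ t (c + 2) = 0 ∧ t (c + 3) = 0 ∧ t (c + 4) = 2) ∨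
      (t (c + 1) = 0 ∧ t (c + 2) = 2 ∧ t (c + 3) = 2 ∧ t (c + 4) = 0)

instance (t : Fin 5 → Fin 3) : Decidable (IsBlockPattern t) :=
  inferInstanceAs (Decidable (_ ∧ _))

/-- As many blocks have count 2 as count 0. One of each would have to coincide modulo 5, so there
are two of each, and the zero sum makes both pairs symmetric about the single block of count 1. The
proof checks all `3 ^ 5` patterns. -/
theorem isBlockPattern_of_sum (t : Fin 5 → Fin 3) (h5 : ∑ v, (t v).val = 5)
    (h0 : (∑ v, v.val * (t v).val) % 5 = 0) (h1 : ¬ ∀ v, t v = 1) : IsBlockPattern t := by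
  have key : ∀ a b c d e : Fin 3, ∑ v, (![a, b, c, d, e] v).val = 5 →
      (∑ v : Fin 5, v.val * (![a, b, c, d, e] v).val) % 5 = 0 →
      (¬ ∀ v, ![a, b, c, d, e] v = 1) → IsBlockPattern ![a, b, c, d, e] := by
    decide +kernel
  have ht : ![t 0, t 1, t 2, t 3, t 4] = t := by
    ext v
    fin_cases v <;> rfl
  have := key (t 0) (t 1) (t 2) (t 3) (t 4)
  rw [ht] at this
  exact this h5 h0 h1

theorem card_eq_sum_blockCount_add (S : Finset (Fin 10)) (c : Fin 5) :
    #S = (blockCount S c).val + (blockCount S (c + 1)).val + (blockCount S (c + 2)).val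
      + (blockCount S (c + 3)).val + (blockCount S (c + 4)).val := by
  rw [← sum_blockCount, ← Equiv.sum_comp (Equiv.addLeft c) fun v => (blockCount S v).val,
    Fin.sum_univ_five]
  simp

/-- The five-element subsets of `Fin 10` with sum divisible by five. -/
def zeroSumSets : Finset (Finset (Fin 10)) :=
  (powersetCard 5 univ).filter fun S => (∑ i ∈ S, i.val) % 5 = 0

theorem isBlockPattern_of_mem {S : Finset (Fin 10)} (hS : S ∈ zeroSumSets)
    (h : ¬ ∀ v, blockCount S v = 1) : IsBlockPattern (blockCount S) := by
  obtain ⟨h5, h0⟩ := Finset.mem_filter.1 hS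
  exact isBlockPattern_of_sum _ ((sum_blockCount S).trans (mem_powersetCard_univ.1 h5))
    ((sum_mul_blockCount S).trans h0) h

/-- With a common centre `c`, equal patterns share at least four points and opposite patterns at
most one. -/
theorem blockCount_pair {S S' : Finset (Fin 10)} (hS : S ∈ zeroSumSets) (hS' : S' ∈ zeroSumSets)
    (h : ¬ ∀ v, blockCount S v = 1) (h' : ¬ ∀ v, blockCount S' v = 1)
    (hi : #(S ∩ S') = 2 ∨ #(S ∩ S') = 3) {c : Fin 5} (hc : blockCount S c = 1) :
    blockCount S' c ≠ 1 := by
  intro hc'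
  have hcard := card_eq_sum_blockCount_add (S ∩ S') c
  have h1 := blockCount_inter_of_eq_one S S' c hc
  rcases (isBlockPattern_of_mem hS h).2 c hc with ⟨a1, a2, a3, a4⟩ | ⟨a1, a2, a3, a4⟩ <;>
    rcases (isBlockPattern_of_mem hS' h').2 c hc' with ⟨b1, b2, b3, b4⟩ | ⟨b1, b2, b3, b4⟩ <;>
    simp only [blockCount_inter_of_eq_two, blockCount_inter_of_eq_zero, a1, a2, a3, a4, b1, b2, b3,
      b4, Fin.val_zero, Fin.val_two] at hcard <;>
    omega

/-- The inner product of the sign vectors is `2 * #(S ∩ S') - 5`. -/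
theorem splitSign_pair {S S' : Finset (Fin 10)} (h : ∀ v, blockCount S v = 1)
    (h' : ∀ v, blockCount S' v = 1) (hi : #(S ∩ S') = 2 ∨ #(S ∩ S') = 3) :
    (∑ v, splitSign S v * splitSign S' v) ^ 2 = 1 := by
  have key : ∀ v, splitSign S v * splitSign S' v = 2 * ((blockCount (S ∩ S') v).val : ℤ) - 1 := by
    intro v
    have hv := h v
    have hv' := h' v
    revert hv hv'
    simp only [blockCount, splitSign, Finset.mem_inter]
    by_cases h1 : Fin.castAdd 5 v ∈ S <;> by_cases h2 : Fin.natAdd 5 v ∈ S <;>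
      by_cases h3 : Fin.castAdd 5 v ∈ S' <;> by_cases h4 : Fin.natAdd 5 v ∈ S' <;>
      simp [h1, h2, h3, h4, -Fin.natAdd_eq_addNat]
  have hsum : (∑ v, ((blockCount (S ∩ S') v).val : ℤ)) = #(S ∩ S') := by
    exact_mod_cast sum_blockCount (S ∩ S')
  rw [Finset.sum_congr rfl fun v _ => key v, Finset.sum_sub_distrib, ← Finset.mul_sum, hsum]
  rcases hi with hi | hi <;> rw [hi] <;> norm_num

/-- The relative bound for equiangular lines with angle `1 / 5` in dimension five. -/
theorem card_le_six_of_signs {ι : Type*} (s : Finset ι) (x : ι → Fin 5 → ℤ)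
    (hx : ∀ a ∈ s, ∀ v, x a v ^ 2 = 1)
    (hs : ∀ a ∈ s, ∀ b ∈ s, a ≠ b → (∑ v, x a v * x b v) ^ 2 = 1) : #s ≤ 6 := by
  classical
  have h1 : ∑ a ∈ s, ∑ b ∈ s, (∑ v, x a v * x b v) ^ 2 = (#s : ℤ) ^ 2 + 24 * #s := by
    have : ∀ a ∈ s, ∑ b ∈ s, (∑ v, x a v * x b v) ^ 2 = #s + 24 := by
      intro a ha
      have : ∀ b ∈ s, (∑ v, x a v * x b v) ^ 2 = 1 + if a = b then 24 else 0 := by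
        intro b hb
        split_ifs with hab
        · subst hab
          simp only [← pow_two, hx a ha]
          norm_num
        · rw [hs a ha b hb hab, add_zero]
      rw [Finset.sum_congr rfl this, Finset.sum_add_distrib, Finset.sum_ite_eq, if_pos ha]
      simp
    rw [Finset.sum_congr rfl this, Finset.sum_const, nsmul_eq_mul]
    ring
  -- The Gram matrix and the 5 by 5 frame matrix have the same sum of squared entries; the diagonal
  -- of the latter alone contributes `5 * #s ^ 2`.
  have h2 : ∑ a ∈ s, ∑ b ∈ s, (∑ v, x a v * x b v) ^ 2
      = ∑ v, ∑ w, (∑ a ∈ s, x a v * x a w) ^ 2 := by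
    simp only [pow_two, Finset.sum_mul_sum]
    rw [Finset.sum_congr rfl fun a _ => Finset.sum_comm, Finset.sum_comm]
    refine Finset.sum_congr rfl fun v _ => ?_
    rw [Finset.sum_congr rfl fun a _ => Finset.sum_comm, Finset.sum_comm]
    refine Finset.sum_congr rfl fun w _ => ?_
    refine Finset.sum_congr rfl fun a _ => Finset.sum_congr rfl fun b _ => ?_
    ring
  have h3 : 5 * (#s : ℤ) ^ 2 ≤ ∑ v, ∑ w, (∑ a ∈ s, x a v * x a w) ^ 2 := by
    have : ∀ v : Fin 5, (#s : ℤ) ^ 2 ≤ ∑ w, (∑ a ∈ s, x a v * x a w) ^ 2 := by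
      intro v
      have hv : ∑ a ∈ s, x a v * x a v = #s := by
        rw [Finset.sum_congr rfl fun a ha => by rw [← pow_two, hx a ha v]]
        simp
      calc (#s : ℤ) ^ 2 = (∑ a ∈ s, x a v * x a v) ^ 2 := by rw [hv]
        _ ≤ _ := Finset.single_le_sum (f := fun w => (∑ a ∈ s, x a v * x a w) ^ 2)
          (fun w _ => sq_nonneg _) (mem_univ v)
    calc 5 * (#s : ℤ) ^ 2 = ∑ _v : Fin 5, (#s : ℤ) ^ 2 := by simp
      _ ≤ _ := Finset.sum_le_sum fun v _ => this v
  by_contra! hc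
  have : (7 : ℤ) ≤ #s := by exact_mod_cast hc
  nlinarith

/-- Sets that split every block give at most six sign vectors; the other sets have distinct centres
among five blocks. -/
theorem IsBalancedFamily.card_le_of_zeroSum {𝒞 : Finset (Finset (Fin 10))}
    (h : IsBalancedFamily 𝒞) (h0 : 𝒞 ⊆ zeroSumSets) : #𝒞 ≤ 11 := by
  rw [← Finset.card_filter_add_card_filter_not (fun S => ∀ v, blockCount S v = 1)]
  have h1 : #(𝒞.filter fun S => ∀ v, blockCount S v = 1) ≤ 6 := by
    refine card_le_six_of_signs _ splitSign ?_ ?_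
    · intro S _ v
      unfold splitSign
      split_ifs <;> norm_num
    · intro S hS S' hS' hne
      rw [Finset.mem_filter] at hS hS'
      exact splitSign_pair hS.2 hS'.2 (h.inter S hS.1 S' hS'.1 hne)
  have h2 : #(𝒞.filter fun S => ¬ ∀ v, blockCount S v = 1) ≤ 5 := by
    have hex : ∀ S ∈ 𝒞.filter (fun S => ¬ ∀ v, blockCount S v = 1), ∃ v, blockCount S v = 1 :=
      fun S hS => (isBlockPattern_of_mem (h0 (Finset.mem_filter.1 hS).1) (Finset.mem_filter.1 hS).2).1
    choose! k hk using hex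
    have := Finset.card_le_card_of_injOn (t := (univ : Finset (Fin 5))) k
      (s := 𝒞.filter fun S => ¬ ∀ v, blockCount S v = 1) (fun _ _ => mem_univ _) ?_
    · simpa using this
    · intro S hS S' hS' hkk
      by_contra hne
      rw [Finset.mem_coe] at hS hS'
      have hkS := hk S hS
      have hkS' := hk S' hS'
      rw [← hkk] at hkS'
      rw [Finset.mem_filter] at hS hS'
      exact blockCount_pair (h0 hS.1) (h0 hS'.1) hS.2 hS'.2 (h.inter S hS.1 S' hS'.1 hne) hkS hkS'
  omega

open LatinLabelling in
theorem exists_perm_of_mult_eq {K : Type*} [DecidableEq K] {f f' : Fin 10 → K}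
    (h : ∀ v, mult f v = mult f' v) : ∃ σ : Equiv.Perm (Fin 10), ∀ c, f' (σ c) = f c := by
  have e : ∀ v, {c // f c = v} ≃ {c // f' c = v} := fun v => Fintype.equivOfCardEq (by
    simpa [mult, Fintype.card_subtype] using h v)
  refine ⟨(Equiv.sigmaFiberEquiv f).symm.trans
    ((Equiv.sigmaCongrRight e).trans (Equiv.sigmaFiberEquiv f')), fun c => ?_⟩
  exact (e (f c) ⟨c, rfl⟩).2

open LatinLabelling in
-- A permutation of the points turns `f` into reduction modulo 5.
theorem IsBalancedFamily.card_le {𝒞 : Finset (Finset (Fin 10))} (h : IsBalancedFamily 𝒞)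
    {f : Fin 10 → ZMod 5} (hf : ∀ v, mult f v = 2) (h0 : ∀ S ∈ 𝒞, ∑ c ∈ S, f c = 0) :
    #𝒞 ≤ 11 := by
  obtain ⟨σ, hσ⟩ := exists_perm_of_mult_eq (f := f) (f' := fun i : Fin 10 => ((i : ℕ) : ZMod 5))
    (fun v => by rw [hf v]; revert v; decide)
  have hinj : Function.Injective (Finset.map σ.toEmbedding) := Finset.map_injective _
  have h' : IsBalancedFamily (𝒞.image (Finset.map σ.toEmbedding)) := by
    constructor
    · simp only [Finset.mem_image]
      rintro _ ⟨S, hS, rfl⟩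
      rw [Finset.card_map, h.card S hS]
    · simp only [Finset.mem_image]
      rintro _ ⟨S, hS, rfl⟩ _ ⟨S', hS', rfl⟩ hne
      rw [← Finset.map_inter, Finset.card_map]
      exact h.inter S hS S' hS' fun he => hne (by rw [he])
  rw [← Finset.card_image_of_injective 𝒞 hinj]
  refine h'.card_le_of_zeroSum ?_
  simp only [Finset.subset_iff, Finset.mem_image, zeroSumSets, Finset.mem_filter,
    Finset.mem_powersetCard_univ]
  rintro _ ⟨S, hS, rfl⟩
  refine ⟨by rw [Finset.card_map, h.card S hS], ?_⟩
  rw [Finset.sum_map]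
  refine Nat.mod_eq_zero_of_dvd ((ZMod.natCast_eq_zero_iff _ 5).1 ?_)
  push_cast
  rw [← h0 S hS]
  exact Finset.sum_congr rfl fun c _ => hσ c

open LatinLabelling in
/-- A labelling of a symmetric Latin square of order ten that splits every member of a large
balanced family evenly is constant. -/
theorem LatinLabelling.const {p : ℕ} [Fact p.Prime] {col : Fin 10 → Fin 10 → Fin 10}
    {f g : Fin 10 → ZMod p} (h : LatinLabelling col f g) {𝒞 : Finset (Finset (Fin 10))}
    (hC : IsBalancedFamily 𝒞) (h12 : 12 ≤ #𝒞)
    (hf : ∀ S ∈ 𝒞, ∑ c ∈ S, f c = ∑ c ∈ Sᶜ, f c) :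
    (∀ c d, f c = f d) ∧ ∀ j k, g j = g k := by
  have h2 : ∀ a : ZMod 2, a + a = 0 := by decide
  have h5 : ∀ a : ZMod 5, a + a = 0 → a = 0 := by decide
  have h5' : ∑ v : ZMod 5, 2 * v = 0 := by decide
  obtain ⟨S, hS⟩ : 𝒞.Nonempty := Finset.card_pos.1 (by omega)
  by_cases hg : ∀ j k, g j = g k
  · exact ⟨h.const_of_const hg (hC.card S hS) (hf S hS), hg⟩
  exfalso
  push Not at hg
  obtain ⟨i₀, j₀, hij⟩ := hg
  rcases h.prime_eq hij with rfl | ⟨rfl, hm⟩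
  · refine h.false_of_two hij ?_
    rw [← Finset.sum_add_sum_compl S, ← hf S hS]
    exact h2 _
  · have hN := h.mult_eq_two_of_five hm
    have hsum : ∑ c, f c = 0 := by
      rw [← Finset.sum_fiberwise_of_maps_to (t := univ) (g := f) (fun _ _ => mem_univ _)]
      have : ∀ v, ∑ c with f c = v, f c = 2 * v := by
        intro v
        rw [Finset.sum_congr rfl fun c hc => (Finset.mem_filter.1 hc).2, Finset.sum_const,
          nsmul_eq_mul]
        congr 1
        exact_mod_cast congrArg (Nat.cast : ℕ → ZMod 5) (hN v)
      rw [Finset.sum_congr rfl fun v _ => this v]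
      exact h5'
    have := hC.card_le hN fun S hS => by
      rw [← Finset.sum_add_sum_compl S, ← hf S hS] at hsum
      exact h5 _ hsum
    omega

/-- A balanced family with twelve members. -/
theorem exists_balancedFamily : ∃ 𝒞 : Finset (Finset (Fin 10)), IsBalancedFamily 𝒞 ∧ #𝒞 = 12 := by
  refine ⟨{{0, 1, 2, 3, 4}, {0, 3, 4, 6, 7}, {0, 2, 4, 6, 8}, {0, 1, 5, 6, 8},
    {0, 1, 2, 7, 8}, {0, 3, 5, 7, 8}, {0, 1, 4, 5, 9}, {0, 2, 3, 6, 9},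
    {0, 2, 5, 7, 9}, {0, 1, 6, 7, 9}, {0, 1, 3, 8, 9}, {0, 4, 7, 8, 9}}, ⟨?_, ?_⟩, ?_⟩ <;>
  decide +kernel


/-! ### Coordinates and the vectors of `X` -/

theorem inner_triple (x y x' y' : Fin 10 → ℝ) (z z' : Fin 2 → ℝ) :
    ⟪triple x y z, triple x' y' z'⟫_ℝ
      = ∑ i, x i * x' i + ∑ i, y i * y' i + ∑ i, z i * z' i := by
  simp only [triple, PiLp.inner_apply, Fintype.sum_sum_type, Sum.elim_inl, Sum.elim_inr,
    RCLike.inner_apply, conj_trivial]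
  simp only [mul_comm, add_assoc]

theorem triple_add (x y x' y' : Fin 10 → ℝ) (z z' : Fin 2 → ℝ) :
    triple x y z + triple x' y' z' = triple (x + x') (y + y') (z + z') := by
  ext i; rcases i with i | i | i <;> simp [triple]

theorem triple_sub (x y x' y' : Fin 10 → ℝ) (z z' : Fin 2 → ℝ) :
    triple x y z - triple x' y' z' = triple (x - x') (y - y') (z - z') := by
  ext i; rcases i with i | i | i <;> simp [triple]

theorem zsmul_triple (k : ℤ) (x y : Fin 10 → ℝ) (z : Fin 2 → ℝ) :
    k • triple x y z = triple ((k : ℝ) • x) ((k : ℝ) • y) ((k : ℝ) • z) := by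
  ext i; rcases i with i | i | i <;> simp [triple]

theorem exists_triple (v : Amb) : ∃ x y z, v = triple x y z :=
  ⟨fun i => v (.inl i), fun i => v (.inr (.inl i)), fun i => v (.inr (.inr i)), by
    ext i; rcases i with i | i | i <;> rfl⟩

theorem sum_mul_alphaA (n : ℕ) {x : Fin (n + 1) → ℝ} (hx : ∑ i, x i = 0) :
    ∑ i, x i * alphaA n i = -x (Fin.last n) := by
  have hn : (n : ℝ) + 1 ≠ 0 := by positivity
  have : ∀ i, x i * alphaA n i = x i * (1 / (n + 1)) - if i = Fin.last n then x i else 0 := by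
    intro i
    unfold alphaA
    split_ifs
    · field_simp; ring
    · ring
  rw [Finset.sum_congr rfl fun i _ => this i, Finset.sum_sub_distrib, ← Finset.sum_mul, hx,
    Finset.sum_ite_eq']
  simp

theorem sum_alphaA (n : ℕ) : ∑ i, alphaA n i = 0 := by
  have hn : (n : ℝ) + 1 ≠ 0 := by positivity
  have : ∀ i, alphaA n i = 1 / (n + 1) - if i = Fin.last n then 1 else 0 := by
    intro i
    unfold alphaA
    split_ifs
    · field_simp; ring
    · ring
  rw [Finset.sum_congr rfl fun i _ => this i, Finset.sum_sub_distrib, Finset.sum_ite_eq']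
  simp [hn]

/-- The vector of the coset of `L` with block representatives `|S| / 10 - 1_S`,
`|T| / 10 - 1_T` and `α_1`. -/
noncomputable def cosetVec (S T : Finset (Fin 10)) : Amb :=
  triple (fun i => #S / 10 - if i ∈ S then 1 else 0) (fun i => #T / 10 - if i ∈ T then 1 else 0)
    (alphaA 1)

theorem sum_indicator_sub_mul (S T : Finset (Fin 10)) :
    ∑ i, ((#S : ℝ) / 10 - if i ∈ S then 1 else 0) * ((#T : ℝ) / 10 - if i ∈ T then 1 else 0)
      = #(S ∩ T) - #S * #T / 10 := by
  have : ∀ i, ((#S : ℝ) / 10 - if i ∈ S then 1 else 0) * ((#T : ℝ) / 10 - if i ∈ T then 1 else 0)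
      = (#S : ℝ) / 10 * (#T / 10) - (#S : ℝ) / 10 * (if i ∈ T then 1 else 0)
        - (#T : ℝ) / 10 * (if i ∈ S then 1 else 0) + if i ∈ S ∩ T then 1 else 0 := by
    intro i
    by_cases hS : i ∈ S <;> by_cases hT : i ∈ T <;> simp [hS, hT] <;> ring
  rw [Finset.sum_congr rfl fun i _ => this i]
  simp only [Finset.sum_add_distrib, Finset.sum_sub_distrib, ← Finset.mul_sum, Finset.sum_boole,
    Finset.filter_univ_mem, Finset.sum_const, Finset.card_univ, Fintype.card_fin, nsmul_eq_mul]
  push_cast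
  ring

theorem alphaA_one : alphaA 1 = ![1 / 2, -1 / 2] := by
  ext i; fin_cases i <;> norm_num [alphaA, Fin.ext_iff]

theorem inner_cosetVec (S T S' T' : Finset (Fin 10)) :
    ⟪cosetVec S T, cosetVec S' T'⟫_ℝ
      = #(S ∩ S') - #S * #S' / 10 + (#(T ∩ T') - #T * #T' / 10) + 1 / 2 := by
  rw [cosetVec, cosetVec, inner_triple, sum_indicator_sub_mul, sum_indicator_sub_mul, alphaA_one]
  simp [Fin.sum_univ_two]
  norm_num

theorem switchingRoot_eq : switchingRoot = triple 0 0 ![1, -1] := by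
  rw [switchingRoot, alphaA_one]
  congr 1
  ext i; fin_cases i <;> norm_num

theorem inner_cosetVec_switchingRoot (S T : Finset (Fin 10)) :
    ⟪cosetVec S T, switchingRoot⟫_ℝ = 1 := by
  rw [cosetVec, switchingRoot_eq, inner_triple, alphaA_one]
  simp [Fin.sum_univ_two]
  norm_num

theorem inner_switchingRoot_self : ⟪switchingRoot, switchingRoot⟫_ℝ = 2 := by
  rw [switchingRoot_eq, inner_triple]
  simp [Fin.sum_univ_two]
  norm_num

theorem switchingRoot_sub_cosetVec (S T : Finset (Fin 10)) :
    switchingRoot - cosetVec S T = cosetVec Sᶜ Tᶜ := by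
  have key : ∀ U : Finset (Fin 10), (0 : Fin 10 → ℝ) - (fun i => (#U : ℝ) / 10 - if i ∈ U then 1 else 0)
      = fun i => (#Uᶜ : ℝ) / 10 - if i ∈ Uᶜ then 1 else 0 := by
    intro U
    ext i
    have hU : #U ≤ 10 := by simpa using Finset.card_le_univ U
    rw [Finset.card_compl, Fintype.card_fin, Nat.cast_sub hU]
    by_cases hi : i ∈ U <;> simp [hi] <;> ring
  rw [cosetVec, switchingRoot, triple_sub, key, key, cosetVec]
  congr 1
  ext i
  simp [two_mul]

theorem cosetVec_univ_right (S : Finset (Fin 10)) : cosetVec S univ = cosetVec S ∅ := by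
  simp [cosetVec]

theorem alpha_mem : alpha ∈ latticeLambda :=
  AddSubgroup.mem_sup_right (AddSubgroup.mem_zmultiples _)

theorem latticeL_le : latticeL ≤ latticeLambda := le_sup_left

/-- The vector is congruent to `#S • alpha` modulo `L`; oddness of `#S` handles the `A_1` block. -/
theorem cosetVec_mem {S T : Finset (Fin 10)} {h q : ℤ} (hS : (#S : ℤ) = 2 * h + 1)
    (hT : (#T : ℤ) = 2 * #S + 10 * q) : cosetVec S T ∈ latticeLambda := by
  have hSr : (#S : ℝ) = 2 * h + 1 := by exact_mod_cast hS
  have hTr : (#T : ℝ) = 2 * #S + 10 * q := by exact_mod_cast hT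
  have hL : cosetVec S T - (#S : ℤ) • alpha ∈ latticeL := by
    rw [alpha, zsmul_triple, cosetVec, triple_sub]
    refine ⟨_, ⟨fun i => ?_, ?_⟩, _, ⟨fun i => ?_, ?_⟩, _, ⟨fun i => ?_, ?_⟩, rfl⟩
    · refine ⟨(if i = Fin.last 9 then (#S : ℤ) else 0) - if i ∈ S then 1 else 0, ?_⟩
      simp only [Pi.sub_apply, Pi.smul_apply, alphaA, smul_eq_mul]
      push_cast
      split_ifs <;> ring
    · simp only [Pi.sub_apply, Pi.smul_apply, Finset.sum_sub_distrib, smul_eq_mul,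
        ← Finset.mul_sum, sum_alphaA]
      simp
      ring
    · refine ⟨q + (if i = Fin.last 9 then 2 * (#S : ℤ) else 0) - if i ∈ T then 1 else 0, ?_⟩
      simp only [Pi.sub_apply, Pi.smul_apply, alphaA, smul_eq_mul]
      rw [hTr]
      push_cast
      split_ifs <;> ring
    · simp only [Pi.sub_apply, Pi.smul_apply, Finset.sum_sub_distrib, smul_eq_mul,
        ← Finset.mul_sum, sum_alphaA]
      simp
      ring
    · refine ⟨if i = 0 then -h else h, ?_⟩
      simp only [Pi.sub_apply, Pi.smul_apply, alphaA_one, smul_eq_mul]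
      push_cast
      rw [hSr]
      fin_cases i <;> simp <;> ring
    · simp only [Pi.sub_apply, Pi.smul_apply, Finset.sum_sub_distrib, smul_eq_mul,
        ← Finset.mul_sum, sum_alphaA]
      simp
  have := add_mem (latticeL_le hL) (zsmul_mem alpha_mem (#S : ℤ))
  rwa [sub_add_cancel] at this

/-- The sizes of the two blocks of the vectors in `X`. -/
def IsShape (S T : Finset (Fin 10)) : Prop :=
  #S = 5 ∧ #T = 0 ∨ #S = 1 ∧ #T = 2 ∨ #S = 9 ∧ #T = 8

theorem IsShape.cosetVec_mem {S T : Finset (Fin 10)} (h : IsShape S T) :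
    cosetVec S T ∈ latticeLambda := by
  rcases h with ⟨hS, hT⟩ | ⟨hS, hT⟩ | ⟨hS, hT⟩
  · exact AffEquiangular.cosetVec_mem (h := 2) (q := -1) (by rw [hS]; rfl) (by rw [hS, hT]; rfl)
  · exact AffEquiangular.cosetVec_mem (h := 0) (q := 0) (by rw [hS]; rfl) (by rw [hS, hT]; rfl)
  · exact AffEquiangular.cosetVec_mem (h := 4) (q := -1) (by rw [hS]; rfl) (by rw [hS, hT]; rfl)

theorem IsShape.mem_setX {S T : Finset (Fin 10)} (h : IsShape S T) : cosetVec S T ∈ setX := by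
  refine ⟨h.cosetVec_mem, ?_, inner_cosetVec_switchingRoot S T⟩
  rw [inner_cosetVec, Finset.inter_self, Finset.inter_self]
  rcases h with ⟨hS, hT⟩ | ⟨hS, hT⟩ | ⟨hS, hT⟩ <;> rw [hS, hT] <;> norm_num

theorem mem_latticeLambda {v : Amb} :
    v ∈ latticeLambda ↔ ∃ l ∈ latticeL, ∃ k : ℤ, v = l + k • alpha := by
  simp only [latticeLambda, AddSubgroup.mem_sup, AddSubgroup.mem_zmultiples_iff]
  constructor
  · rintro ⟨l, hl, _, ⟨k, rfl⟩, rfl⟩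
    exact ⟨l, hl, k, rfl⟩
  · rintro ⟨l, hl, k, rfl⟩
    exact ⟨l, hl, _, ⟨k, rfl⟩, rfl⟩

/-! ### Short vectors of the dual lattice -/

/-- A vector with coordinate sum zero and integral differences is a vector `a / 10 - n` with `n`
integral of coordinate sum `a` and `0 ≤ a ≤ 9`. -/
theorem exists_glue {x : Fin 10 → ℝ} (h0 : ∑ i, x i = 0)
    (hx : ∀ i, ∃ m : ℤ, x i - x (Fin.last 9) = m) :
    ∃ (a : ℕ) (n : Fin 10 → ℤ), a < 10 ∧ ∑ i, n i = a ∧ ∀ i, x i = a / 10 - n i := by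
  choose m hm using hx
  have hs : (∑ i, m i : ℝ) = -10 * x (Fin.last 9) := by
    rw [← Finset.sum_congr rfl fun i _ => hm i, Finset.sum_sub_distrib, h0, Finset.sum_const, Finset.card_univ,
      Fintype.card_fin, nsmul_eq_mul]
    push_cast
    ring
  -- `N` is ten times the last coordinate; its residue modulo 10 is the glue class.
  set N : ℤ := -∑ i, m i with hN
  have hNr : (N : ℝ) = 10 * x (Fin.last 9) := by
    rw [hN, Int.cast_neg, Int.cast_sum, hs]; ring
  have hd : (N : ℝ) = (N % 10 : ℤ) + 10 * (N / 10 : ℤ) := by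
    exact_mod_cast (Int.emod_add_mul_ediv N 10).symm
  have hnn : 0 ≤ N % 10 := Int.emod_nonneg _ (by norm_num)
  have hcast : (((N % 10).toNat : ℕ) : ℤ) = N % 10 := Int.toNat_of_nonneg hnn
  refine ⟨(N % 10).toNat, fun i => -m i - N / 10, ?_, ?_, fun i => ?_⟩
  · have := Int.emod_lt_of_pos N (by norm_num : (0 : ℤ) < 10)
    omega
  · rw [hcast, Finset.sum_sub_distrib, Finset.sum_neg_distrib, ← hN]
    simp
    omega
  · have : (((N % 10).toNat : ℕ) : ℝ) = (N % 10 : ℤ) := by exact_mod_cast hcast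
    rw [this]
    push_cast
    have := hm i
    linarith

theorem sum_sq_glue {x : Fin 10 → ℝ} {a : ℕ} {n : Fin 10 → ℤ} (hn : ∑ i, n i = a)
    (hx : ∀ i, x i = a / 10 - n i) : ∑ i, x i * x i = (∑ i, n i ^ 2 : ℤ) - (a : ℝ) ^ 2 / 10 := by
  have hnr : ∑ i, (n i : ℝ) = a := by exact_mod_cast hn
  have : ∀ i, x i * x i = (a : ℝ) ^ 2 / 100 - (a : ℝ) / 5 * n i + (n i : ℝ) ^ 2 := fun i => by
    rw [hx]; ring
  rw [Finset.sum_congr rfl fun i _ => this i]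
  simp only [Finset.sum_add_distrib, Finset.sum_sub_distrib, ← Finset.mul_sum, hnr]
  simp
  ring

theorem le_sum_sq {n : Fin 10 → ℤ} {a : ℕ} (hn : ∑ i, n i = a) : (a : ℤ) ≤ ∑ i, n i ^ 2 := by
  rw [← hn]
  exact Finset.sum_le_sum fun i _ => Int.le_self_sq _

/-- Equality in `∑ n ≤ ∑ n ^ 2` forces the coordinates to be `0` or `1`. -/
theorem exists_finset_of_sum_sq {n : Fin 10 → ℤ} {a : ℕ} (hn : ∑ i, n i = a)
    (hs : ∑ i, n i ^ 2 ≤ a) : ∃ S : Finset (Fin 10), #S = a ∧ ∀ i, n i = if i ∈ S then 1 else 0 := by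
  have h01 : ∀ i, n i = 0 ∨ n i = 1 := by
    have := (Finset.sum_eq_sum_iff_of_le (s := univ) (fun i _ => Int.le_self_sq (n i))).1
      (le_antisymm (Finset.sum_le_sum fun i _ => Int.le_self_sq _) (by rw [hn]; exact hs))
    intro i
    have h := this i (mem_univ i)
    have : n i * (n i - 1) = 0 := by linarith
    rcases mul_eq_zero.1 this with h | h
    · exact Or.inl h
    · exact Or.inr (by omega)
  have hif : ∀ i, n i = if i ∈ univ.filter (fun i => n i = 1) then 1 else 0 := by
    intro i
    rcases h01 i with h | h <;> simp [h]
  refine ⟨univ.filter (fun i => n i = 1), ?_, hif⟩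
  rw [Finset.sum_congr rfl fun i _ => hif i, Finset.sum_boole, Finset.filter_univ_mem] at hn
  exact_mod_cast hn

theorem triple_mem_latticeL {x y : Fin 10 → ℝ} {z : Fin 2 → ℝ} (hx : x ∈ rootLatticeA 9)
    (hy : y ∈ rootLatticeA 9) (hz : z ∈ rootLatticeA 1) : triple x y z ∈ latticeL :=
  ⟨x, hx, y, hy, z, hz, rfl⟩

/-- The vector `e_i - e_9` of `A_9`. -/
noncomputable def stdRoot (i : Fin 10) : Fin 10 → ℝ := Pi.single i 1 - Pi.single (Fin.last 9) 1

theorem stdRoot_mem (i : Fin 10) : stdRoot i ∈ rootLatticeA 9 := by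
  refine ⟨fun j => ⟨(Pi.single i 1 - Pi.single (Fin.last 9) 1 : Fin 10 → ℤ) j, ?_⟩, ?_⟩
  · simp [stdRoot, Pi.single_apply]
  · simp [stdRoot, Finset.sum_sub_distrib]

theorem sum_mul_stdRoot (x : Fin 10 → ℝ) (i : Fin 10) :
    ∑ j, x j * stdRoot i j = x i - x (Fin.last 9) := by
  simp [stdRoot, mul_sub, Finset.sum_sub_distrib, Pi.single_apply]

/-- The all-ones vector of each block is orthogonal to `Λ`, hence to its span. -/
theorem block_sums_of_mem_span {x y : Fin 10 → ℝ} {z : Fin 2 → ℝ}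
    (h : triple x y z ∈ Submodule.span ℝ (latticeLambda : Set Amb)) :
    ∑ i, x i = 0 ∧ ∑ i, y i = 0 ∧ ∑ i, z i = 0 := by
  have key : ∀ x' y' : Fin 10 → ℝ, ∀ z' : Fin 2 → ℝ,
      (∀ w ∈ latticeLambda, ⟪triple x' y' z', w⟫_ℝ = 0) → ⟪triple x' y' z', triple x y z⟫_ℝ = 0 := by
    intro x' y' z' hw
    have hle : Submodule.span ℝ (latticeLambda : Set Amb)
        ≤ LinearMap.ker (innerₛₗ ℝ (triple x' y' z')) :=
      Submodule.span_le.2 fun w hw' => by simpa using hw w hw'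
    simpa using hle h
  have hsum : ∀ w ∈ latticeLambda, ∃ x y z, w = triple x y z ∧
      ∑ i, x i = 0 ∧ ∑ i, y i = 0 ∧ ∑ i, z i = 0 := by
    intro w hw
    obtain ⟨_, ⟨x, hx, y, hy, z, hz, rfl⟩, k, rfl⟩ := mem_latticeLambda.1 hw
    refine ⟨_, _, _, by rw [alpha, zsmul_triple, triple_add], ?_, ?_, ?_⟩
    all_goals
      simp only [Pi.add_apply, Pi.smul_apply, Finset.sum_add_distrib, ← Finset.smul_sum,
        sum_alphaA, smul_zero, add_zero]
    exacts [hx.2, hy.2, hz.2]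
  refine ⟨?_, ?_, ?_⟩
  · have := key (fun _ => 1) 0 0 fun w hw => by
      obtain ⟨x, y, z, rfl, hx, -, -⟩ := hsum w hw
      simp [inner_triple, hx]
    simpa [inner_triple] using this
  · have := key 0 (fun _ => 1) 0 fun w hw => by
      obtain ⟨x, y, z, rfl, -, hy, -⟩ := hsum w hw
      simp [inner_triple, hy]
    simpa [inner_triple] using this
  · have := key 0 0 (fun _ => 1) fun w hw => by
      obtain ⟨x, y, z, rfl, -, -, hz⟩ := hsum w hw
      simp only [inner_triple, one_mul, hz]
      simp
    simpa [inner_triple] using this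

/-- The short vectors of the dual lattice whose inner product with the switching root is one. -/
theorem exists_isShape_of_mem_dualLattice {v : Amb} (hv : v ∈ dualLattice latticeLambda)
    (h3 : ⟪v, v⟫_ℝ ≤ 3) (hr : ⟪v, switchingRoot⟫_ℝ = 1) :
    ∃ S T, IsShape S T ∧ v = cosetVec S T := by
  obtain ⟨x, y, z, rfl⟩ := exists_triple v
  obtain ⟨hspan, hint⟩ := hv
  obtain ⟨hx0, hy0, hz0⟩ := block_sums_of_mem_span hspan
  have hz : z = alphaA 1 := by
    rw [switchingRoot_eq, inner_triple] at hr
    simp [Fin.sum_univ_two] at hr hz0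
    rw [alphaA_one]
    ext i
    fin_cases i <;> simp <;> linarith
  subst hz
  obtain ⟨a, n, ha, hn, hxn⟩ := exists_glue hx0 fun i => by
    obtain ⟨m, hm⟩ := hint (triple (stdRoot i) 0 0)
      (latticeL_le (triple_mem_latticeL (stdRoot_mem i) (zero_mem _) (zero_mem _)))
    refine ⟨m, ?_⟩
    rw [← hm, inner_triple, sum_mul_stdRoot]
    simp
  obtain ⟨b, m, hb, hm, hym⟩ := exists_glue hy0 fun i => by
    obtain ⟨m, hm⟩ := hint (triple 0 (stdRoot i) 0)
      (latticeL_le (triple_mem_latticeL (zero_mem _) (stdRoot_mem i) (zero_mem _)))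
    refine ⟨m, ?_⟩
    rw [← hm, inner_triple, sum_mul_stdRoot]
    simp
  -- Integrality of the inner product with `alpha`; the 5 comes from `(α_1, α_1) = 1/2`.
  have hab : (a + 2 * b) % 10 = 5 := by
    obtain ⟨q, hq⟩ := hint alpha alpha_mem
    rw [alpha, inner_triple] at hq
    simp only [Pi.smul_apply, smul_eq_mul, mul_left_comm _ (2 : ℝ), ← Finset.mul_sum] at hq
    rw [sum_mul_alphaA 9 hx0, sum_mul_alphaA 9 hy0, sum_mul_alphaA 1 (sum_alphaA 1), hxn, hym,
      alphaA_one] at hq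
    simp at hq
    have h1 : ((a + 2 * b : ℤ) : ℝ) = ((5 + 10 * (n (Fin.last 9) + 2 * m (Fin.last 9) - q) : ℤ) : ℝ)
      := by push_cast; linarith
    have h2 : (a + 2 * b : ℤ) = 5 + 10 * (n (Fin.last 9) + 2 * m (Fin.last 9) - q) := by
      exact_mod_cast h1
    omega
  rw [inner_triple, sum_sq_glue hn hxn, sum_sq_glue hm hym, alphaA_one] at h3
  have hnorm : 10 * (∑ i, n i ^ 2) - (a : ℤ) ^ 2 + (10 * (∑ i, m i ^ 2) - (b : ℤ) ^ 2) ≤ 25 := by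
    have : (10 * ((∑ i, n i ^ 2 : ℤ) : ℝ) - (a : ℝ) ^ 2
        + (10 * ((∑ i, m i ^ 2 : ℤ) : ℝ) - (b : ℝ) ^ 2)) ≤ 25 := by
      simp only [Fin.sum_univ_two, Matrix.cons_val_zero, Matrix.cons_val_one] at h3
      linarith
    exact_mod_cast this
  have hna := le_sum_sq hn
  have hmb := le_sum_sq hm
  -- The lower bounds give `a(10 - a) + b(10 - b) ≤ 25`. Each pair also meeting the congruence
  -- attains equality, so there is no slack in either sum of squares.
  have hcases : (a = 5 ∧ b = 0 ∨ a = 1 ∧ b = 2 ∨ a = 9 ∧ b = 8) ∧ ∑ i, n i ^ 2 ≤ a ∧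
      ∑ i, m i ^ 2 ≤ b := by
    generalize ∑ i, n i ^ 2 = A at *
    generalize ∑ i, m i ^ 2 = B at *
    clear hn hm hxn hym
    interval_cases b <;> interval_cases a <;> simp at hab <;> norm_num at * <;> omega
  obtain ⟨hcases, hA, hB⟩ := hcases
  obtain ⟨S, hS, hnS⟩ := exists_finset_of_sum_sq hn hA
  obtain ⟨T, hT, hmT⟩ := exists_finset_of_sum_sq hm hB
  refine ⟨S, T, by rw [IsShape, hS, hT]; exact hcases, ?_⟩
  rw [cosetVec]
  congr 1
  · ext i; rw [hxn, hnS, hS]; simp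
  · ext i; rw [hym, hmT, hT]; simp

theorem latticeLambda_subset_dualLattice : (latticeLambda : Set Amb) ⊆ dualLattice latticeLambda := by
  intro v hv
  refine ⟨Submodule.subset_span hv, fun w hw => ?_⟩
  obtain ⟨_, ⟨x, hx, y, hy, z, hz, rfl⟩, k, rfl⟩ := mem_latticeLambda.1 hv
  obtain ⟨_, ⟨x', hx', y', hy', z', hz', rfl⟩, k', rfl⟩ := mem_latticeLambda.1 hw
  have hdot : ∀ {n : ℕ} {x x' : Fin (n + 1) → ℝ}, x ∈ rootLatticeA n → x' ∈ rootLatticeA n →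
      ∃ m : ℤ, ∑ i, x i * x' i = m := by
    intro n x x' hx hx'
    choose a ha using hx.1
    choose b hb using hx'.1
    exact ⟨∑ i, a i * b i, by push_cast; simp only [ha, hb]⟩
  have hα : ∀ {x y : Fin 10 → ℝ} {z : Fin 2 → ℝ}, x ∈ rootLatticeA 9 → y ∈ rootLatticeA 9 →
      z ∈ rootLatticeA 1 → ∃ m : ℤ, ⟪triple x y z, alpha⟫_ℝ = m := by
    intro x y z hx hy hz
    obtain ⟨a, ha⟩ := hx.1 (Fin.last 9)
    obtain ⟨b, hb⟩ := hy.1 (Fin.last 9)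
    obtain ⟨c, hc⟩ := hz.1 (Fin.last 1)
    refine ⟨-a - 2 * b - c, ?_⟩
    rw [alpha, inner_triple]
    simp only [Pi.smul_apply, smul_eq_mul, mul_left_comm _ (2 : ℝ), ← Finset.mul_sum]
    rw [sum_mul_alphaA 9 hx.2, sum_mul_alphaA 9 hy.2, sum_mul_alphaA 1 hz.2, ha, hb, hc]
    push_cast
    ring
  have hαα : ⟪alpha, alpha⟫_ℝ = 5 := by
    rw [alpha, inner_triple]
    simp only [Pi.smul_apply, smul_eq_mul, mul_left_comm _ (2 : ℝ), mul_assoc, ← Finset.mul_sum]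
    rw [sum_mul_alphaA 9 (sum_alphaA 9), sum_mul_alphaA 1 (sum_alphaA 1)]
    norm_num [alphaA, Fin.ext_iff]
  obtain ⟨m₁, h₁⟩ := hdot hx hx'
  obtain ⟨m₂, h₂⟩ := hdot hy hy'
  obtain ⟨m₃, h₃⟩ := hdot hz hz'
  obtain ⟨m₄, h₄⟩ := hα hx hy hz
  obtain ⟨m₅, h₅⟩ := hα hx' hy' hz'
  refine ⟨m₁ + m₂ + m₃ + k' * m₄ + k * m₅ + k * k' * 5, ?_⟩
  rw [inner_add_left, inner_add_right, inner_add_right, ← Int.cast_smul_eq_zsmul ℝ k,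
    ← Int.cast_smul_eq_zsmul ℝ k', inner_smul_left, inner_smul_left, inner_smul_right,
    inner_smul_right, hαα, h₄, real_inner_comm _ alpha, h₅, inner_triple, h₁, h₂, h₃]
  simp
  ring

theorem mem_setX_iff {v : Amb} : v ∈ setX ↔ ∃ S T, IsShape S T ∧ v = cosetVec S T := by
  constructor
  · rintro ⟨hv, h3, hr⟩
    exact exists_isShape_of_mem_dualLattice (latticeLambda_subset_dualLattice hv) h3.le hr
  · rintro ⟨S, T, h, rfl⟩
    exact h.mem_setX


/-! ### Characters and generation of `Λ` -/

/-- A proper subgroup of a finitely generated commutative group lies in the kernel of a nonzero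
character with values in a prime field. -/
theorem exists_zmod_character {V : Type*} [AddCommGroup V] {Γ M : AddSubgroup V} (hΓ : Γ.FG)
    (hM : ¬ Γ ≤ M) : ∃ (p : ℕ) (_ : Fact p.Prime) (χ : Γ →+ ZMod p), χ ≠ 0 ∧
      ∀ x (hx : x ∈ Γ), x ∈ M → χ ⟨x, hx⟩ = 0 := by
  have : Module.Finite ℤ Γ :=
    Module.Finite.iff_addGroup_fg.2 ((AddGroup.fg_iff_addSubgroup_fg Γ).2 hΓ)
  set N : Submodule ℤ Γ := AddSubgroup.toIntSubmodule (M.addSubgroupOf Γ) with hN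
  have hNtop : N ≠ ⊤ := by
    intro h
    refine hM fun x hx => ?_
    have : (⟨x, hx⟩ : Γ) ∈ N := h ▸ Submodule.mem_top
    exact this
  obtain ⟨N', hN', hle⟩ := (eq_top_or_exists_le_coatom N).resolve_left hNtop
  have hsimple : IsSimpleModule ℤ (Γ ⧸ N') := isSimpleModule_iff_isCoatom.2 hN'
  obtain ⟨I, hI, ⟨e⟩⟩ := isSimpleModule_iff_quot_maximal.1 hsimple
  have hI0 : I ≠ ⊥ := Ring.ne_bot_of_isMaximal_of_not_isField hI Int.not_isField
  obtain ⟨n, rfl⟩ : ∃ n : ℕ, I = Ideal.span {(n : ℤ)} := by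
    obtain ⟨a, rfl⟩ := (IsPrincipalIdealRing.principal I).principal
    exact ⟨a.natAbs, (Int.span_natAbs a).symm⟩
  have hn : n.Prime := by
    have h0 : (n : ℤ) ≠ 0 := fun h => hI0 (by rw [h]; simp)
    exact Nat.prime_iff_prime_int.2 ((Ideal.span_singleton_prime h0).1 hI.isPrime)
  let ψ : (Γ ⧸ N') →+ ZMod n :=
    (Int.quotientSpanNatEquivZMod n).toAddEquiv.toAddMonoidHom.comp e.toAddEquiv.toAddMonoidHom
  have hψ : Function.Injective ψ :=
    (Int.quotientSpanNatEquivZMod n).injective.comp e.injective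
  refine ⟨n, ⟨hn⟩, ψ.comp N'.mkQ.toAddMonoidHom, fun h => hN'.1 ?_, fun x hx hxM => ?_⟩
  · rw [Submodule.eq_top_iff']
    intro x
    have hx : ψ (N'.mkQ x) = 0 := DFunLike.congr_fun h x
    rw [← map_zero ψ] at hx
    exact (Submodule.Quotient.mk_eq_zero N').1 (hψ hx)
  · have hx' : N'.mkQ ⟨x, hx⟩ = 0 := (Submodule.Quotient.mk_eq_zero N').2 (hle hxM)
    change ψ (N'.mkQ ⟨x, hx⟩) = 0
    rw [hx', map_zero]

theorem switchingRoot_mem : switchingRoot ∈ latticeLambda := by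
  rw [switchingRoot_eq]
  refine latticeL_le (triple_mem_latticeL (zero_mem _) (zero_mem _) ⟨fun i => ?_, ?_⟩)
  · refine ⟨if i = 0 then 1 else -1, ?_⟩
    fin_cases i <;> simp
  · simp [Fin.sum_univ_two]

theorem stdRoot_left_mem (i : Fin 10) : triple (stdRoot i) 0 0 ∈ latticeLambda :=
  latticeL_le (triple_mem_latticeL (stdRoot_mem i) (zero_mem _) (zero_mem _))

theorem stdRoot_right_mem (i : Fin 10) : triple 0 (stdRoot i) 0 ∈ latticeLambda :=
  latticeL_le (triple_mem_latticeL (zero_mem _) (stdRoot_mem i) (zero_mem _))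

theorem eq_sum_stdRoot {x : Fin 10 → ℝ} (hx : ∑ i, x i = 0) : x = ∑ i, x i • stdRoot i := by
  have h : ∑ i, x i • stdRoot i
      = ∑ i, x i • Pi.single i (1 : ℝ) - (∑ i, x i) • Pi.single (Fin.last 9) (1 : ℝ) := by
    simp only [stdRoot, smul_sub, Finset.sum_sub_distrib, Finset.sum_smul]
  rw [h, hx, zero_smul, sub_zero]
  ext j
  simp [Finset.sum_apply, Pi.single_apply]

theorem latticeLambda_le {K : AddSubgroup Amb} (hl : ∀ i, triple (stdRoot i) 0 0 ∈ K)
    (hr : ∀ i, triple 0 (stdRoot i) 0 ∈ K) (hs : switchingRoot ∈ K) (hα : alpha ∈ K) :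
    latticeLambda ≤ K := by
  intro v hv
  obtain ⟨_, ⟨x, hx, y, hy, z, hz, rfl⟩, k, rfl⟩ := mem_latticeLambda.1 hv
  refine add_mem ?_ (zsmul_mem hα k)
  choose a ha using hx.1
  choose b hb using hy.1
  obtain ⟨c, hc⟩ := hz.1 0
  have : triple x y z = ∑ i, a i • triple (stdRoot i) 0 0 + ∑ i, b i • triple 0 (stdRoot i) 0
      + c • switchingRoot := by
    have hx' := eq_sum_stdRoot hx.2
    have hy' := eq_sum_stdRoot hy.2
    have hz' := hz.2
    rw [Fin.sum_univ_two] at hz'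
    simp only [ha] at hx'
    simp only [hb] at hy'
    rw [switchingRoot_eq]
    simp only [zsmul_triple]
    ext i
    rcases i with i | i | i
    · simpa [triple, Finset.sum_apply] using congrFun hx' i
    · simpa [triple, Finset.sum_apply] using congrFun hy' i
    · fin_cases i
      · simp [triple, hc]
      · simp [triple, ← hc]
        linarith
  rw [this]
  exact add_mem (add_mem (sum_mem fun i _ => zsmul_mem (hl i) _)
    (sum_mem fun i _ => zsmul_mem (hr i) _)) (zsmul_mem hs _)

theorem latticeLambda_fg : latticeLambda.FG := by
  let s : Set Amb := Set.range (fun i => triple (stdRoot i) 0 0)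
    ∪ Set.range (fun i => triple 0 (stdRoot i) 0) ∪ {switchingRoot, alpha}
  have hs : s.Finite := by
    refine ((Set.finite_range _).union (Set.finite_range _)).union ?_
    exact (Set.finite_singleton _).insert _
  have hle : ∀ x ∈ s, x ∈ AddSubgroup.closure s := fun x hx => AddSubgroup.subset_closure hx
  rw [AddSubgroup.fg_iff]
  refine ⟨s, le_antisymm ?_ ?_, hs⟩
  · rw [AddSubgroup.closure_le]
    rintro x ((⟨i, rfl⟩ | ⟨i, rfl⟩) | rfl | rfl)
    exacts [stdRoot_left_mem i, stdRoot_right_mem i, switchingRoot_mem, alpha_mem]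
  · exact latticeLambda_le (fun i => hle _ (Or.inl (Or.inl ⟨i, rfl⟩)))
      (fun i => hle _ (Or.inl (Or.inr ⟨i, rfl⟩))) (hle _ (Or.inr (Or.inl rfl)))
      (hle _ (Or.inr (Or.inr rfl)))

/-- Under a character killing the edge vector, this identity becomes the label rule. -/
theorem cosetVec_singleton_pair {i j k : Fin 10} (hjk : j ≠ k) :
    cosetVec {i} {j, k}
      = alpha - triple (stdRoot i) 0 0 - triple 0 (stdRoot j) 0 - triple 0 (stdRoot k) 0 := by
  rw [cosetVec, alpha, triple_sub, triple_sub, triple_sub, Finset.card_pair hjk,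
    Finset.card_singleton]
  congr 1
  · ext l
    simp only [stdRoot, alphaA, Pi.sub_apply, Pi.zero_apply, Pi.single_apply,
      Finset.mem_singleton]
    split_ifs <;> norm_num
  · ext l
    have : (if l ∈ ({j, k} : Finset (Fin 10)) then (1 : ℝ) else 0)
        = (if l = j then 1 else 0) + if l = k then 1 else 0 := by
      by_cases h1 : l = j
      · simp [h1, hjk]
      · simp [h1]
    simp only [this, stdRoot, alphaA, Pi.sub_apply, Pi.zero_apply, Pi.single_apply, Pi.smul_apply,
      smul_eq_mul]
    split_ifs <;> norm_num
  · simp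

theorem sum_stdRoot_left (S : Finset (Fin 10)) :
    ∑ i ∈ S, triple (stdRoot i) 0 0
      = triple ((fun i => if i ∈ S then 1 else 0) - (#S : ℝ) • Pi.single (Fin.last 9) 1) 0 0 := by
  ext i
  rcases i with i | i | i
  · simp [triple, stdRoot, Finset.sum_apply, Pi.single_apply]
  · simp [triple]
  · simp [triple]

/-- Under a character killing both vectors, this says that the labels on `S` and on its complement
have equal sums. -/
theorem cosetVec_compl_sub {S : Finset (Fin 10)} (hS : #S = 5) :
    cosetVec Sᶜ ∅ - cosetVec S ∅
      = ∑ i ∈ S, triple (stdRoot i) 0 0 - ∑ i ∈ Sᶜ, triple (stdRoot i) 0 0 := by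
  have hS' : #Sᶜ = 5 := by rw [Finset.card_compl, hS]; rfl
  rw [sum_stdRoot_left, sum_stdRoot_left, cosetVec, cosetVec, triple_sub, triple_sub, hS, hS']
  congr 1
  · ext i
    by_cases hi : i ∈ S <;> simp [hi]
    ring
  · simp
  · simp

/-- A subgroup containing the switching root, a vector for each edge of a proper edge colouring of
the complete graph and the vectors of a large balanced family contains `Λ`. -/
theorem latticeLambda_le_of_mem {M : AddSubgroup Amb} (hr : switchingRoot ∈ M)
    {col : Fin 10 → Fin 10 → Fin 10} (hsymm : ∀ j k, col j k = col k j)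
    (hbij : ∀ j, Function.Bijective (col j))
    (hcol : ∀ j k, j ≠ k → cosetVec {col j k} {j, k} ∈ M)
    {𝒞 : Finset (Finset (Fin 10))} (hC : IsBalancedFamily 𝒞) (h12 : 12 ≤ #𝒞)
    (hM : ∀ S ∈ 𝒞, cosetVec S ∅ ∈ M) : latticeLambda ≤ M := by
  by_contra hle
  obtain ⟨p, hp, χ, hχ, hχM⟩ := exists_zmod_character latticeLambda_fg hle
  set F : Fin 10 → ZMod p := fun i => χ ⟨_, stdRoot_left_mem i⟩ with hF
  set G : Fin 10 → ZMod p := fun i => χ ⟨_, stdRoot_right_mem i⟩ with hG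
  set a : ZMod p := χ ⟨_, alpha_mem⟩ with ha
  have hrel : ∀ j k, j ≠ k → a - F (col j k) - G j - G k = 0 := by
    intro j k hjk
    have hmem : cosetVec {col j k} {j, k} ∈ latticeLambda := by
      rw [cosetVec_singleton_pair hjk]
      exact sub_mem (sub_mem (sub_mem alpha_mem (stdRoot_left_mem _)) (stdRoot_right_mem _))
        (stdRoot_right_mem _)
    have := hχM _ hmem (hcol j k hjk)
    rw [← this, ha, hF, hG]
    simp only [← map_sub]
    congr 1
    exact Subtype.ext (cosetVec_singleton_pair hjk).symm
  have hbal : ∀ S ∈ 𝒞, ∑ c ∈ S, F c = ∑ c ∈ Sᶜ, F c := by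
    intro S hS
    have hS' : cosetVec Sᶜ ∅ ∈ M := by
      have := sub_mem hr (hM S hS)
      rwa [switchingRoot_sub_cosetVec, Finset.compl_empty, cosetVec_univ_right] at this
    have hmem : cosetVec Sᶜ ∅ - cosetVec S ∅ ∈ latticeLambda := by
      rw [cosetVec_compl_sub (hC.card S hS)]
      exact sub_mem (sum_mem fun i _ => stdRoot_left_mem i) (sum_mem fun i _ => stdRoot_left_mem i)
    have := hχM _ hmem (sub_mem hS' (hM S hS))
    rw [← sub_eq_zero, ← this, hF]
    simp only [← map_sum, ← map_sub]
    congr 1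
    refine Subtype.ext (Eq.trans ?_ (cosetVec_compl_sub (hC.card S hS)).symm)
    simp
  have hlab : LatinLabelling col (fun c => a - F c) G := by
    refine ⟨hsymm, hbij, fun j k hjk => ?_⟩
    have := hrel j k hjk
    linear_combination this
  obtain ⟨hfc, hgc⟩ := hlab.const hC h12 fun S hS => by
    rw [Finset.sum_sub_distrib, Finset.sum_sub_distrib, hbal S hS, Finset.sum_const,
      Finset.sum_const, Finset.card_compl, hC.card S hS]
    rfl
  -- Index 9 gives the zero root, so constant values on the roots of a block are zero.
  have hlast : stdRoot (Fin.last 9) = 0 := sub_self _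
  have htriple : triple 0 0 0 = 0 := by
    ext i; rcases i with i | i | i <;> rfl
  have hl0 : triple (stdRoot (Fin.last 9)) 0 0 = 0 := by rw [hlast, htriple]
  have hr0 : triple 0 (stdRoot (Fin.last 9)) 0 = 0 := by rw [hlast, htriple]
  have hF0 : ∀ i, F i = 0 := by
    have h9 : F (Fin.last 9) = 0 := by
      rw [← map_zero χ, hF]
      exact congrArg χ (Subtype.ext hl0)
    intro i
    have : a - F i = a - F (Fin.last 9) := hfc i (Fin.last 9)
    rwa [sub_right_inj, h9] at this
  have hG0 : ∀ i, G i = 0 := by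
    have h9 : G (Fin.last 9) = 0 := by
      rw [← map_zero χ, hG]
      exact congrArg χ (Subtype.ext hr0)
    intro i
    rw [hgc i (Fin.last 9), h9]
  have ha0 : a = 0 := by
    have := hrel 0 1 (by decide)
    rwa [hF0, hG0, hG0, sub_zero, sub_zero, sub_zero] at this
  have hker : latticeLambda ≤ χ.ker.map latticeLambda.subtype :=
    latticeLambda_le (fun i => ⟨⟨_, stdRoot_left_mem i⟩, hF0 i, rfl⟩)
      (fun i => ⟨⟨_, stdRoot_right_mem i⟩, hG0 i, rfl⟩)
      ⟨⟨_, switchingRoot_mem⟩, hχM _ switchingRoot_mem hr, rfl⟩ ⟨⟨_, alpha_mem⟩, ha0, rfl⟩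
  refine hχ (AddMonoidHom.ext fun x => ?_)
  obtain ⟨y, hy, hyx⟩ := hker x.2
  have : y = x := Subtype.ext hyx
  rw [← this]
  exact hy


/-! ### The structure of maximum sets -/

theorem isAES_image {ι : Type*} (s : Finset ι) (F : ι → Amb) (hX : ∀ a ∈ s, F a ∈ setX)
    (hp : ∀ a ∈ s, ∀ b ∈ s, a ≠ b → ⟪F a, F b⟫_ℝ = 0 ∨ ⟪F a, F b⟫_ℝ = 1) :
    IsAES 3 switchingRoot (F '' s) ∧ (F '' s).ncard = #s := by
  refine ⟨⟨by norm_num, inner_switchingRoot_self, s.finite_toSet.image F, ?_, ?_, ?_⟩, ?_⟩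
  · rintro _ ⟨a, ha, rfl⟩
    exact (hX a ha).2.2
  · rintro _ ⟨a, ha, rfl⟩
    exact (hX a ha).2.1
  · rintro _ ⟨a, ha, rfl⟩ _ ⟨b, hb, rfl⟩ hne
    exact hp a ha b hb fun h => hne (by rw [h])
  · rw [Set.InjOn.ncard_image, Set.ncard_coe_finset]
    intro a ha b hb hab
    by_contra hne
    have h3 := (hX a ha).2.1
    have := hp a ha b hb hne
    rw [← hab, h3] at this
    norm_num at this

/-- The edge colouring of the complete graph on `Fin 10` by sums modulo nine, where the vertex
`9` is the point at infinity. -/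
def sumColour (T : Finset (Fin 10)) : Fin 10 :=
  Fin.ofNat 10 ((if 9 ∈ T then 2 * ∑ i ∈ T, i.val else ∑ i ∈ T, i.val) % 9)

/-- An edge from `i` to infinity gets `2 * (i + 9) ≡ 2 * i`, the colour that the finite edges at `i`
leave unused; these colours are distinct because 2 is invertible modulo 9. -/
theorem sumColour_ne : ∀ i j k : Fin 10, i ≠ j → i ≠ k → j ≠ k →
    sumColour {i, j} ≠ sumColour {i, k} := by
  decide +kernel

theorem sumColour_pair {T T' : Finset (Fin 10)} (hT : #T = 2) (hT' : #T' = 2) (hne : T ≠ T') :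
    #(T ∩ T') = 0 ∨ #(T ∩ T') = 1 ∧ sumColour T ≠ sumColour T' := by
  rcases (T ∩ T').eq_empty_or_nonempty with h | ⟨i, hi⟩
  · exact Or.inl (by rw [h, Finset.card_empty])
  obtain ⟨hiT, hiT'⟩ := Finset.mem_inter.1 hi
  obtain ⟨j, hj⟩ := Finset.card_eq_one.1 (by rw [Finset.card_erase_of_mem hiT, hT] : #(T.erase i) = 1)
  obtain ⟨k, hk⟩ := Finset.card_eq_one.1
    (by rw [Finset.card_erase_of_mem hiT', hT'] : #(T'.erase i) = 1)
  have hij : i ≠ j := (Finset.ne_of_mem_erase (hj ▸ Finset.mem_singleton_self j)).symm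
  have hik : i ≠ k := (Finset.ne_of_mem_erase (hk ▸ Finset.mem_singleton_self k)).symm
  rw [← Finset.insert_erase hiT, hj, ← Finset.insert_erase hiT', hk] at hne ⊢
  have hjk : j ≠ k := fun h => hne (by rw [h])
  refine Or.inr ⟨?_, sumColour_ne i j k hij hik hjk⟩
  rw [← Finset.insert_inter_distrib, Finset.singleton_inter_of_notMem (by simpa using hjk)]
  rfl

theorem inner_edge (i i' : Fin 10) {T T' : Finset (Fin 10)} (hT : #T = 2) (hT' : #T' = 2) :
    ⟪cosetVec {i} T, cosetVec {i'} T'⟫_ℝ = #(({i} : Finset (Fin 10)) ∩ {i'}) + #(T ∩ T') := by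
  rw [inner_cosetVec, hT, hT', Finset.card_singleton, Finset.card_singleton]
  push_cast
  ring

theorem inner_half {S S' : Finset (Fin 10)} (hS : #S = 5) (hS' : #S' = 5) :
    ⟪cosetVec S ∅, cosetVec S' ∅⟫_ℝ = #(S ∩ S') - 2 := by
  rw [inner_cosetVec, hS, hS', Finset.card_empty, Finset.inter_self, Finset.card_empty]
  push_cast
  ring

theorem inner_edge_half (i : Fin 10) {T S : Finset (Fin 10)} (hS : #S = 5) :
    ⟪cosetVec {i} T, cosetVec S ∅⟫_ℝ = #({i} ∩ S) := by
  rw [inner_cosetVec, hS, Finset.card_singleton, Finset.inter_empty, Finset.card_empty]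
  push_cast
  ring

theorem card_singleton_inter_le (i : Fin 10) (S : Finset (Fin 10)) :
    #({i} ∩ S) = 0 ∨ #({i} ∩ S) = 1 := by
  have := Finset.card_le_card (Finset.inter_subset_left (s₁ := {i}) (s₂ := S))
  rw [Finset.card_singleton] at this
  omega

/-- Any balanced family may be joined to the 45 edges coloured by `sumColour`, since edges and
five-element sets always have inner product 0 or 1. -/
theorem IsMaximumAES.le_ncard {ω : Set Amb} (hω : IsMaximumAES 3 switchingRoot setX ω)
    {𝒞 : Finset (Finset (Fin 10))} (hC : IsBalancedFamily 𝒞) : 45 + #𝒞 ≤ ω.ncard := by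
  let s := (powersetCard 2 (univ : Finset (Fin 10))).disjSum 𝒞
  let F : Finset (Fin 10) ⊕ Finset (Fin 10) → Amb :=
    Sum.elim (fun T => cosetVec {sumColour T} T) (fun S => cosetVec S ∅)
  have hX : ∀ a ∈ s, F a ∈ setX := by
    rintro (T | S) ha
    · have hT := (mem_powersetCard_univ.1 (Finset.inl_mem_disjSum.1 ha))
      exact IsShape.mem_setX (Or.inr (Or.inl ⟨Finset.card_singleton _, hT⟩))
    · exact IsShape.mem_setX (Or.inl ⟨hC.card S (Finset.inr_mem_disjSum.1 ha), rfl⟩)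
  have hp : ∀ a ∈ s, ∀ b ∈ s, a ≠ b → ⟪F a, F b⟫_ℝ = 0 ∨ ⟪F a, F b⟫_ℝ = 1 := by
    have hmix : ∀ T S, S ∈ 𝒞 → ⟪F (.inl T), F (.inr S)⟫_ℝ = 0 ∨ ⟪F (.inl T), F (.inr S)⟫_ℝ = 1 := by
      intro T S hS
      change ⟪cosetVec {sumColour T} T, cosetVec S ∅⟫_ℝ = 0
        ∨ ⟪cosetVec {sumColour T} T, cosetVec S ∅⟫_ℝ = 1
      rw [inner_edge_half _ (hC.card S hS)]
      exact_mod_cast card_singleton_inter_le _ S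
    rintro (T | S) ha (T' | S') hb hne
    · have hT := Finset.inl_mem_disjSum.1 ha
      have hT' := Finset.inl_mem_disjSum.1 hb
      rw [mem_powersetCard_univ] at hT hT'
      change ⟪cosetVec {sumColour T} T, cosetVec {sumColour T'} T'⟫_ℝ = 0
        ∨ ⟪cosetVec {sumColour T} T, cosetVec {sumColour T'} T'⟫_ℝ = 1
      rw [inner_edge _ _ hT hT']
      rcases sumColour_pair hT hT' fun h => hne (by rw [h]) with h | ⟨h, hc⟩
      · rw [h]
        exact_mod_cast card_singleton_inter_le _ _
      · rw [h, Finset.singleton_inter_of_notMem (by simpa using hc)]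
        simp
    · exact hmix T S' (Finset.inr_mem_disjSum.1 hb)
    · rw [real_inner_comm]
      exact hmix T' S (Finset.inr_mem_disjSum.1 ha)
    · have hS := Finset.inr_mem_disjSum.1 ha
      have hS' := Finset.inr_mem_disjSum.1 hb
      change ⟪cosetVec S ∅, cosetVec S' ∅⟫_ℝ = 0 ∨ ⟪cosetVec S ∅, cosetVec S' ∅⟫_ℝ = 1
      rw [inner_half (hC.card S hS) (hC.card S' hS')]
      rcases hC.inter S hS S' hS' fun h => hne (by rw [h]) with h | h <;> rw [h] <;> norm_num
  obtain ⟨hA, hcard⟩ := isAES_image s F hX hp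
  have := hω.2.2 _ hA (by rintro _ ⟨a, ha, rfl⟩; exact hX a ha)
  rw [hcard, Finset.card_disjSum, Finset.card_powersetCard, Finset.card_univ,
    Fintype.card_fin] at this
  exact this

/-- `v` is, up to switching, the vector of the edge `T` with colour `i`. -/
def IsEdgeVec (v : Amb) (i : Fin 10) (T : Finset (Fin 10)) : Prop :=
  #T = 2 ∧ (v = cosetVec {i} T ∨ v = switchingRoot - cosetVec {i} T)

/-- Replacing one vector `u` by `r - u` changes an inner product `t` to `1 - t`, which preserves the
set of allowed values 0 and 1. -/
theorem IsEdgeVec.inner {u v : Amb} {i i' : Fin 10} {T T' : Finset (Fin 10)}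
    (hu : IsEdgeVec u i T) (hv : IsEdgeVec v i' T') :
    ⟪u, v⟫_ℝ = #(({i} : Finset (Fin 10)) ∩ {i'}) + #(T ∩ T') ∨
      ⟪u, v⟫_ℝ = 1 - (#(({i} : Finset (Fin 10)) ∩ {i'}) + #(T ∩ T')) := by
  have h := inner_edge i i' hu.1 hv.1
  have h1 := inner_cosetVec_switchingRoot {i} T
  have h2 := inner_cosetVec_switchingRoot {i'} T'
  have h3 := inner_switchingRoot_self
  rw [real_inner_comm] at h2
  rcases hu.2 with rfl | rfl <;> rcases hv.2 with rfl | rfl <;>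
    simp only [inner_sub_left, inner_sub_right, h, h1, h2, h3, true_or, or_true]
  left
  ring

theorem IsEdgeVec.le_one {u v : Amb} {i i' : Fin 10} {T T' : Finset (Fin 10)}
    (hu : IsEdgeVec u i T) (hv : IsEdgeVec v i' T') (h : ⟪u, v⟫_ℝ = 0 ∨ ⟪u, v⟫_ℝ = 1) :
    #(({i} : Finset (Fin 10)) ∩ {i'}) + #(T ∩ T') ≤ 1 := by
  have hi := hu.inner hv
  have : ((#(({i} : Finset (Fin 10)) ∩ {i'}) + #(T ∩ T') : ℕ) : ℝ) ≤ (1 : ℕ) := by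
    push_cast
    rcases h with h | h <;> rcases hi with hi | hi <;> linarith
  exact_mod_cast this

/-- A maximum affine equiangular set consists of a proper edge colouring of the complete graph on
ten vertices together with a large balanced family. -/
theorem IsMaximumAES.exists_colouring {ω : Set Amb}
    (hω : IsMaximumAES 3 switchingRoot setX ω) :
    (∃ (c : Finset (Fin 10) → Fin 10) (V : Finset (Fin 10) → Amb),
      (∀ T, #T = 2 → V T ∈ ω ∧ IsEdgeVec (V T) (c T) T) ∧
      ∀ T T', #T = 2 → #T' = 2 → #(T ∩ T') = 1 → c T ≠ c T') ∧
    ∃ 𝒞 : Finset (Finset (Fin 10)), IsBalancedFamily 𝒞 ∧ 12 ≤ #𝒞 ∧ ∀ S ∈ 𝒞, cosetVec S ∅ ∈ ω := by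
  classical
  obtain ⟨hA, hsub, -⟩ := id hω
  let 𝒞 : Finset (Finset (Fin 10)) := univ.filter fun S => #S = 5 ∧ cosetVec S ∅ ∈ ω
  let 𝒯 : Finset (Finset (Fin 10)) :=
    (powersetCard 2 univ).filter fun T => ∃ v ∈ ω, ∃ i, IsEdgeVec v i T
  have hCmem : ∀ S, S ∈ 𝒞 ↔ #S = 5 ∧ cosetVec S ∅ ∈ ω := fun S => by simp [𝒞]
  have hC : IsBalancedFamily 𝒞 := by
    refine ⟨fun S hS => ((hCmem S).1 hS).1, fun S hS S' hS' hne => ?_⟩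
    obtain ⟨h5, hSω⟩ := (hCmem S).1 hS
    obtain ⟨h5', hSω'⟩ := (hCmem S').1 hS'
    have hin := inner_half h5 h5'
    by_cases he : cosetVec S ∅ = cosetVec S' ∅
    · exfalso
      rw [← he, hA.inner_self _ hSω] at hin
      have hc : #(S ∩ S') = 5 := by
        have : (#(S ∩ S') : ℝ) = (5 : ℕ) := by push_cast; linarith
        exact_mod_cast this
      have e1 := Finset.eq_of_subset_of_card_le (Finset.inter_subset_left (s₁ := S) (s₂ := S'))
        (by omega)
      have e2 := Finset.eq_of_subset_of_card_le (Finset.inter_subset_right (s₁ := S) (s₂ := S'))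
        (by omega)
      exact hne (e1.symm.trans e2)
    · rcases hA.inner_ne _ hSω _ hSω' he with h | h
      · left
        have : (#(S ∩ S') : ℝ) = (2 : ℕ) := by push_cast; linarith
        exact_mod_cast this
      · right
        have : (#(S ∩ S') : ℝ) = (3 : ℕ) := by push_cast; linarith
        exact_mod_cast this
  have hV : ∀ T ∈ 𝒯, ∃ v ∈ ω, ∃ i, IsEdgeVec v i T := fun T hT => (Finset.mem_filter.1 hT).2
  choose! V hVω c hVc using hV
  -- Two distinct members of `ω` cannot belong to the same edge, because `#(T ∩ T) = 2` exceeds the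
  -- bound one.
  have hcover : ω ⊆ (V '' 𝒯) ∪ ((fun S => cosetVec S ∅) '' 𝒞) := by
    intro v hv
    have hedge : ∀ i T, IsEdgeVec v i T → v ∈ V '' 𝒯 := by
      intro i T h
      have hT : T ∈ 𝒯 := Finset.mem_filter.2 ⟨mem_powersetCard_univ.2 h.1, v, hv, i, h⟩
      refine ⟨T, hT, ?_⟩
      by_contra hne
      have := (hVc T hT).le_one h (hA.inner_ne _ (hVω T hT) _ hv hne)
      rw [Finset.inter_self, h.1] at this
      omega
    obtain ⟨S, T, hST, rfl⟩ := mem_setX_iff.1 (hsub hv)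
    rcases hST with ⟨hS, hT⟩ | ⟨hS, hT⟩ | ⟨hS, hT⟩
    · rw [Finset.card_eq_zero] at hT
      subst hT
      exact Or.inr ⟨S, (hCmem S).2 ⟨hS, hv⟩, rfl⟩
    · obtain ⟨i, rfl⟩ := Finset.card_eq_one.1 hS
      exact Or.inl (hedge i T ⟨hT, Or.inl rfl⟩)
    · have hS' : #Sᶜ = 1 := by rw [Finset.card_compl, hS]; rfl
      have hT' : #Tᶜ = 2 := by rw [Finset.card_compl, hT]; rfl
      obtain ⟨i, hi⟩ := Finset.card_eq_one.1 hS'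
      refine Or.inl (hedge i Tᶜ ⟨hT', Or.inr ?_⟩)
      rw [← hi, switchingRoot_sub_cosetVec, compl_compl, compl_compl]
  have hcard : ω.ncard ≤ #𝒯 + #𝒞 := by
    refine (Set.ncard_le_ncard hcover ((𝒯.finite_toSet.image _).union
      (𝒞.finite_toSet.image _))).trans ((Set.ncard_union_le _ _).trans (add_le_add ?_ ?_))
    · exact (Set.ncard_image_le 𝒯.finite_toSet).trans (Set.ncard_coe_finset 𝒯).le
    · exact (Set.ncard_image_le 𝒞.finite_toSet).trans (Set.ncard_coe_finset 𝒞).le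
  have h45 : #(powersetCard 2 (univ : Finset (Fin 10))) = 45 := by
    rw [Finset.card_powersetCard, Finset.card_univ, Fintype.card_fin]; rfl
  have hTle : #𝒯 ≤ 45 := h45 ▸ Finset.card_le_card (Finset.filter_subset _ _)
  -- Comparison with the family of `ω` itself forces all 45 edges to occur; comparison with the
  -- explicit family then forces `12 ≤ #𝒞`.
  have h1 := hω.le_ncard hC
  obtain ⟨𝒟, hD, hD12⟩ := exists_balancedFamily
  have h2 := hω.le_ncard hD
  have hTall : 𝒯 = powersetCard 2 univ :=
    Finset.eq_of_subset_of_card_le (Finset.filter_subset _ _) (by omega)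
  have hmem : ∀ T : Finset (Fin 10), #T = 2 → T ∈ 𝒯 := fun T hT => by
    rw [hTall]; exact mem_powersetCard_univ.2 hT
  refine ⟨⟨c, V, fun T hT => ⟨hVω T (hmem T hT), hVc T (hmem T hT)⟩, ?_⟩,
    𝒞, hC, by omega, fun S hS => ((hCmem S).1 hS).2⟩
  intro T T' hT hT' h1 hcc
  have e := hVc T (hmem T hT)
  have e' := hVc T' (hmem T' hT')
  by_cases hne : V T = V T'
  · have h3 := hA.inner_self _ (hVω T (hmem T hT))
    have := e.inner e'
    rw [← hne, h3, h1, hcc, Finset.inter_self, Finset.card_singleton] at this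
    norm_num at this
  · have := e.le_one e' (hA.inner_ne _ (hVω T (hmem T hT)) _ (hVω T' (hmem T' hT')) hne)
    rw [h1, hcc, Finset.inter_self, Finset.card_singleton] at this
    omega

theorem IsMaximumAES.closure_eq {ω : Set Amb} (hω : IsMaximumAES 3 switchingRoot setX ω) :
    AddSubgroup.closure (ω ∪ {switchingRoot}) = latticeLambda := by
  obtain ⟨⟨c, V, hV, hc⟩, 𝒞, hC, h12, hCω⟩ := hω.exists_colouring
  set M := AddSubgroup.closure (ω ∪ {switchingRoot}) with hM
  have hr : switchingRoot ∈ M := AddSubgroup.subset_closure (Or.inr rfl)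
  have hωM : ∀ v ∈ ω, v ∈ M := fun v hv => AddSubgroup.subset_closure (Or.inl hv)
  refine le_antisymm ?_ ?_
  · rw [hM, AddSubgroup.closure_le]
    rintro v (hv | rfl)
    · exact (hω.2.1 hv).1
    · exact switchingRoot_mem
  have hinj : ∀ j : Fin 10, ∀ k ∈ univ.erase j, ∀ l ∈ univ.erase j,
      c {j, k} = c {j, l} → k = l := by
    intro j k hk l hl hkl
    by_contra hne
    have hk' : j ≠ k := (Finset.ne_of_mem_erase hk).symm
    have hl' : j ≠ l := (Finset.ne_of_mem_erase hl).symm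
    refine hc {j, k} {j, l} (Finset.card_pair hk') (Finset.card_pair hl') ?_ hkl
    have : ({j, k} : Finset (Fin 10)) ∩ {j, l} = {j} := by
      ext i
      simp only [Finset.mem_inter, Finset.mem_insert, Finset.mem_singleton]
      constructor
      · rintro ⟨h | h, h' | h'⟩
        · exact h
        · exact h
        · exact h'
        · exact absurd (h.symm.trans h') hne
      · rintro rfl
        exact ⟨Or.inl rfl, Or.inl rfl⟩
    rw [this, Finset.card_singleton]
  -- Nine edges at `j` leave a colour free; it is put on the diagonal to complete a symmetric Latin
  -- square.
  have hmiss : ∀ j : Fin 10, ∃ m, m ∉ (univ.erase j).image fun k => c {j, k} := by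
    intro j
    by_contra! hall
    have h := Finset.card_le_card (fun m _ => hall m : univ ⊆ _)
    have h' := h.trans Finset.card_image_le
    rw [Finset.card_erase_of_mem (mem_univ j), Finset.card_univ, Fintype.card_fin] at h'
    omega
  choose m hm using hmiss
  let col : Fin 10 → Fin 10 → Fin 10 := fun j k => if j = k then m j else c {j, k}
  refine latticeLambda_le_of_mem hr (col := col) ?_ ?_ ?_ hC h12 fun S hS => hωM _ (hCω S hS)
  · intro j k
    by_cases hjk : j = k
    · rw [hjk]
    · simp only [col, if_neg hjk, if_neg (Ne.symm hjk), Finset.pair_comm]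
  · intro j
    refine Finite.injective_iff_bijective.1 fun k l hkl => ?_
    have hmem : ∀ k, j ≠ k → k ∈ univ.erase j := fun k hk =>
      Finset.mem_erase.2 ⟨hk.symm, mem_univ k⟩
    by_cases hk : j = k <;> by_cases hl : j = l
    · exact hk.symm.trans hl
    · simp only [col, if_pos hk, if_neg hl] at hkl
      exact absurd (Finset.mem_image.2 ⟨l, hmem l hl, hkl.symm⟩) (hm j)
    · simp only [col, if_neg hk, if_pos hl] at hkl
      exact absurd (Finset.mem_image.2 ⟨k, hmem k hk, hkl⟩) (hm j)
    · simp only [col, if_neg hk, if_neg hl] at hkl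
      exact hinj j k (hmem k hk) l (hmem l hl) hkl
  · intro j k hjk
    simp only [col, if_neg hjk]
    obtain ⟨hVω, -, hv⟩ := hV {j, k} (Finset.card_pair hjk)
    have hVM := hωM _ hVω
    rcases hv with hv | hv
    · rwa [← hv]
    · have := sub_mem hr hVM
      rwa [hv, sub_sub_cancel] at this

/-! ### Strong maximality -/

/-- The vector of a subspace representing the inner product with a vector of a larger space. -/
theorem exists_mem_inner_eq {V W : Type*} [NormedAddCommGroup V] [InnerProductSpace ℝ V]
    [FiniteDimensional ℝ V] [NormedAddCommGroup W] [InnerProductSpace ℝ W]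
    (f : V →ₗᵢ[ℝ] W) (P : Submodule ℝ V) (w : W) :
    ∃ v ∈ P, (∀ x ∈ P, ⟪v, x⟫_ℝ = ⟪w, f x⟫_ℝ) ∧ ⟪v, v⟫_ℝ ≤ ⟪w, w⟫_ℝ := by
  set Q := P.map f.toLinearMap with hQ
  obtain ⟨v, hvP, hv⟩ := (Submodule.mem_map).1 (Q.starProjection_apply_mem w)
  have hv' : f v = Q.starProjection w := hv
  have hin : ∀ x ∈ P, ⟪v, x⟫_ℝ = ⟪w, f x⟫_ℝ := by
    intro x hx
    have := Q.starProjection_inner_eq_zero w (f x) (Submodule.mem_map_of_mem hx)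
    rw [inner_sub_left, sub_eq_zero] at this
    rw [this, ← hv', f.inner_map_map]
  refine ⟨v, hvP, hin, ?_⟩
  have h := hin v hvP
  have h0 := real_inner_self_nonneg (x := w - f v)
  rw [inner_sub_left, inner_sub_right, inner_sub_right, f.inner_map_map, real_inner_comm w (f v),
    ← h] at h0
  linarith

theorem IsMaximumAES.isStronglyMaximal {ω : Set Amb}
    (hω : IsMaximumAES 3 switchingRoot setX ω) : IsStronglyMaximal 3 switchingRoot ω := by
  refine ⟨hω.1, fun N f ω' hω' hss => ?_⟩
  obtain ⟨w, hw, hwf⟩ := Set.exists_of_ssubset hss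
  have hclosure := hω.closure_eq
  obtain ⟨v, hvP, hv, hvw⟩ :=
    exists_mem_inner_eq f (Submodule.span ℝ (latticeLambda : Set Amb)) w
  have hspan : ∀ x ∈ latticeLambda, x ∈ Submodule.span ℝ (latticeLambda : Set Amb) :=
    fun x hx => Submodule.subset_span hx
  have hωv : ∀ u ∈ ω, ⟪v, u⟫_ℝ = 0 ∨ ⟪v, u⟫_ℝ = 1 := by
    intro u hu
    rw [hv u (hspan u (hω.2.1 hu).1)]
    refine hω'.inner_ne w hw (f u) (hss.1 ⟨u, hu, rfl⟩) ?_
    rintro rfl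
    exact hwf ⟨u, hu, rfl⟩
  have hvr : ⟪v, switchingRoot⟫_ℝ = 1 := by
    rw [hv _ (hspan _ switchingRoot_mem), hω'.inner_root w hw]
  have hdual : v ∈ dualLattice latticeLambda := by
    refine ⟨hvP, fun x hx => ?_⟩
    rw [← hclosure] at hx
    induction hx using AddSubgroup.closure_induction with
    | mem x hx =>
      rcases hx with hx | rfl
      · rcases hωv x hx with h | h
        · exact ⟨0, by rw [h, Int.cast_zero]⟩
        · exact ⟨1, by rw [h, Int.cast_one]⟩
      · exact ⟨1, by rw [hvr, Int.cast_one]⟩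
    | zero => exact ⟨0, by simp⟩
    | add x y _ _ hx hy =>
      obtain ⟨a, ha⟩ := hx
      obtain ⟨b, hb⟩ := hy
      exact ⟨a + b, by rw [inner_add_right, ha, hb, Int.cast_add]⟩
    | neg x _ hx =>
      obtain ⟨a, ha⟩ := hx
      exact ⟨-a, by rw [inner_neg_right, ha, Int.cast_neg]⟩
  have hww := hω'.inner_self w hw
  obtain ⟨S, T, hST, hvST⟩ := exists_isShape_of_mem_dualLattice hdual (hww ▸ hvw) hvr
  have hvX : v ∈ setX := hvST ▸ hST.mem_setX
  -- The projection already has the full norm 3, so nothing of `w` lies outside the image.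
  have hwv : w = f v := by
    rw [← sub_eq_zero, ← inner_self_eq_zero (𝕜 := ℝ), inner_sub_left, inner_sub_right,
      inner_sub_right, f.inner_map_map, real_inner_comm w (f v), ← hv v hvP, hvX.2.1, hww]
    norm_num
  have hvω : v ∉ ω := fun h => hwf ⟨v, h, hwv.symm⟩
  have hins : IsAES 3 switchingRoot (insert v ω) := by
    obtain ⟨h1, h2, h3, h4, h5, h6⟩ := hω.1
    refine ⟨h1, h2, h3.insert v, ?_, ?_, ?_⟩
    · rintro u (rfl | hu)
      · exact hvr
      · exact h4 u hu
    · rintro u (rfl | hu)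
      · exact hvX.2.1
      · exact h5 u hu
    · rintro u (rfl | hu) u' (rfl | hu') hne
      · exact absurd rfl hne
      · exact hωv u' hu'
      · rw [real_inner_comm]
        exact hωv u hu
      · exact h6 u hu u' hu' hne
  have := hω.2.2 _ hins (Set.insert_subset hvX hω.2.1)
  rw [Set.ncard_insert_of_notMem hvω hω.1.finite] at this
  omega

end AffEquiangular

theorem mainTheorem4 :
    (∀ ω : Set AffEquiangular.Amb,
      AffEquiangular.IsMaximumAES 3 AffEquiangular.switchingRoot AffEquiangular.setX ω →
        AffEquiangular.IsStronglyMaximal 3 AffEquiangular.switchingRoot ω ∧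
        AddSubgroup.closure (ω ∪ {AffEquiangular.switchingRoot}) =
          AffEquiangular.latticeLambda) ∧
    ¬ ∃ v : AffEquiangular.Amb,
      v ∈ AffEquiangular.dualLattice AffEquiangular.latticeLambda ∧
      v ∉ AffEquiangular.latticeLambda ∧
      inner ℝ v v ≤ 3 ∧ inner ℝ v AffEquiangular.switchingRoot = 1 := by
  refine ⟨fun ω hω => ⟨hω.isStronglyMaximal, hω.closure_eq⟩, ?_⟩
  rintro ⟨v, hv, hvΛ, h3, hr⟩
  obtain ⟨S, T, hST, rfl⟩ := AffEquiangular.exists_isShape_of_mem_dualLattice hv h3 hr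
  exact hvΛ hST.cosetVec_mem
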